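/- Let $\alpha<\beta$, let $a\in C^1[\alpha,\beta]$ be real-valued and strictly positive on $[\alpha,\beta]$, and let $V\in L^\infty(\alpha,\beta)$ be real-valued. Let $H$ be the Sturm–Liouville operator $Hf=-(af')'+Vf$ in $L^2(\alpha,\beta)$ with Neumann boundary conditions: its domain consists of the $f\in L^2(\alpha,\beta)$ (identified with a suitable representative) that are differentiable on $[\alpha,\beta]$ with $af'$ absolutely continuous, $-(af')'+Vf\in L^2(\alpha,\beta)$ and $f'(\alpha)=f'(\beta)=0$. The eigenvalues of $H$, written in increasing order and repeated according to multiplicity, form a sequence $\lambda_0\le\lambda_1\le\lambda_2\le\dots$ of real numbers. Suppose that $a_0\le a(x)\le a_1$ for all $x\in(\alpha,\beta)$ and $v_0\le V(x)\le v_1$ for almost every $x\in(\alpha,\beta)$. Then for all $i=0,1,2,\dots$ $$\frac{a_0\pi^2i^2}{(\beta-\alpha)^2}+v_0\;\le\;\lambda_i\;\le\;\frac{a_1\pi^2i^2}{(\beta-\alpha)^2}+v_1 .$$ Moreover, let $E'$ be a real number, let $M$ be the smallest positive integer such that $E'\le v_0+M^2a_0\pi^2/(\beta-\alpha)^2$ (assume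 that one exists), and suppose that $$0\le v_1-v_0\le \frac{a_0\pi^2}{(\beta-\alpha)^2}\qquad\text{and}\qquad 0\le v_1-v_0\le \frac{M^2a_0\pi^2}{(\beta-\alpha)^2}-\frac{(M-1)^2a_1\pi^2}{(\beta-\alpha)^2}.$$ Then the enclosure intervals of any two eigenvalues $\lambda_i,\lambda_j$ with $i\ne j$, $\lambda_i<E'$ and $\lambda_j<E'$ do not overlap: the open intervals with the above endpoints are disjoint. If in addition $v_1-v_0<a_0\pi^2/(\beta-\alpha)^2$, then the closed enclosure intervals themselves are disjoint. -/

import Mathlib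

open MeasureTheory Set

/-- The complex Hilbert space `L²(α, β)`. -/
abbrev L2Interval (α β : ℝ) : Type :=
  Lp ℂ 2 ((volume : Measure ℝ).restrict (Ioo α β))

/-- The graph of the Neumann Sturm-Liouville operator `H f = -(a f')' + V f` in `L²(α, β)`.
A pair `(f, g)` belongs to it when `f` has a representative `u` that is differentiable on `[α, β]`,
satisfies the boundary conditions `u'(α) = u'(β) = 0`, and is such that `a u'` is absolutely
continuous on `[α, β]` with `(a u')' = V u - g` almost everywhere; the last condition is written
in its integrated form (recall that `a u'` vanishes at `α`). -/
noncomputable def neumannGraph (α β : ℝ) (a V : ℝ → ℝ) :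
    Submodule ℂ (L2Interval α β × L2Interval α β) where
  carrier := {p | ∃ u : ℝ → ℂ,
    p.1 =ᵐ[volume.restrict (Ioo α β)] u ∧
    DifferentiableOn ℝ u (Icc α β) ∧
    derivWithin u (Icc α β) α = 0 ∧
    derivWithin u (Icc α β) β = 0 ∧
    IntegrableOn (fun t => (V t : ℂ) * u t) (Ioo α β) ∧
    ∀ x ∈ Icc α β,
      (a x : ℂ) * derivWithin u (Icc α β) x = ∫ t in α..x, ((V t : ℂ) * u t - p.2 t)}
  zero_mem' := by
    refine ⟨0, Lp.coeFn_zero _ _ _, differentiableOn_const _, by simp, by simp, by simp, ?_⟩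
    intro x hx
    have h : ∀ᵐ t ∂volume.restrict (Ioo α x),
        (V t : ℂ) * (0 : ℝ → ℂ) t - (0 : L2Interval α β) t = 0 := by
      have h0 := Lp.coeFn_zero ℂ 2 ((volume : Measure ℝ).restrict (Ioo α β))
      filter_upwards [ae_restrict_of_ae_restrict_of_subset (Ioo_subset_Ioo_right hx.2) h0]
        with t ht
      simpa using ht
    rw [intervalIntegral.integral_of_le hx.1, integral_Ioc_eq_integral_Ioo]
    simpa using (integral_eq_zero_of_ae h).symm
  add_mem' := by
    rintro ⟨f₁, g₁⟩ ⟨f₂, g₂⟩ ⟨u₁, e₁, d₁, l₁, r₁, i₁, h₁⟩ ⟨u₂, e₂, d₂, l₂, r₂, i₂, h₂⟩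
    have hd : ∀ x ∈ Icc α β, derivWithin (u₁ + u₂) (Icc α β) x =
        derivWithin u₁ (Icc α β) x + derivWithin u₂ (Icc α β) x := fun x hx =>
      derivWithin_add (d₁ x hx) (d₂ x hx)
    have hi : ∀ g : L2Interval α β, IntegrableOn g (Ioo α β) := fun g =>
      (Lp.memLp g).integrable (by norm_num)
    have hb : derivWithin (u₁ + u₂) (Icc α β) α = 0 ∧ derivWithin (u₁ + u₂) (Icc α β) β = 0 := by
      rcases le_or_gt α β with h | h
      · rw [hd α (left_mem_Icc.2 h), hd β (right_mem_Icc.2 h)]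
        simp_all
      · constructor <;> exact derivWithin_zero_of_notMem_closure (by simp [Icc_eq_empty_of_lt h])
    refine ⟨u₁ + u₂, ?_, d₁.add d₂, hb.1, hb.2, ?_, ?_⟩
    · exact (Lp.coeFn_add f₁ f₂).trans (e₁.add e₂)
    · refine (i₁.add i₂).congr ?_
      filter_upwards with t
      simp [mul_add]
    · intro x hx
      have hs : Ioo α x ⊆ Ioo α β := Ioo_subset_Ioo_right hx.2
      have j₁ : IntegrableOn (fun t => (V t : ℂ) * u₁ t - g₁ t) (Ioo α x) :=
        (i₁.sub (hi g₁)).mono_set hs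
      have j₂ : IntegrableOn (fun t => (V t : ℂ) * u₂ t - g₂ t) (Ioo α x) :=
        (i₂.sub (hi g₂)).mono_set hs
      rw [hd x hx, mul_add, h₁ x hx, h₂ x hx]
      simp only [intervalIntegral.integral_of_le hx.1, integral_Ioc_eq_integral_Ioo]
      rw [← integral_add j₁ j₂]
      refine integral_congr_ae ?_
      filter_upwards [ae_restrict_of_ae_restrict_of_subset hs (Lp.coeFn_add g₁ g₂)] with t ht
      simp only [Prod.mk_add_mk, ht, Pi.add_apply]
      ring
  smul_mem' := by
    rintro c ⟨f, g⟩ ⟨u, e, d, l, r, i, h⟩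
    have hd : ∀ x, derivWithin (c • u) (Icc α β) x = c * derivWithin u (Icc α β) x := fun x => by
      simpa using derivWithin_const_smul_field (𝕜 := ℝ) (x := x) (s := Icc α β) c u
    refine ⟨c • u, ?_, d.const_smul c, by rw [hd]; simp [l], by rw [hd]; simp [r], ?_, ?_⟩
    · exact (Lp.coeFn_smul c f).trans (e.const_smul c)
    · refine (i.const_mul c).congr ?_
      filter_upwards with t
      simp
      ring
    · intro x hx
      have hs : Ioo α x ⊆ Ioo α β := Ioo_subset_Ioo_right hx.2
      rw [hd, mul_left_comm, h x hx]
      simp only [intervalIntegral.integral_of_le hx.1, integral_Ioc_eq_integral_Ioo]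
      rw [← integral_const_mul]
      refine integral_congr_ae ?_
      filter_upwards [ae_restrict_of_ae_restrict_of_subset hs (Lp.coeFn_smul c g)] with t ht
      simp only [Prod.smul_mk, ht, Pi.smul_apply, smul_eq_mul]
      ring

/-- The Neumann Sturm-Liouville operator `H f = -(a f')' + V f`, as an unbounded operator in
`L²(α, β)`. -/
noncomputable def neumannOperator (α β : ℝ) (a V : ℝ → ℝ) :
    L2Interval α β →ₗ.[ℂ] L2Interval α β :=
  (neumannGraph α β a V).toLinearPMap

/-- The graph above is single-valued. -/
theorem neumannGraph_single_valued (α β : ℝ) (a V : ℝ → ℝ) :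
    ∀ p ∈ neumannGraph α β a V, p.1 = 0 → p.2 = 0 := by
  rintro ⟨f, g⟩ ⟨u, e, d, -, -, -, h⟩ (rfl : f = 0)
  simp only at e h
  change g = 0
  refine (Lp.eq_zero_iff_ae_eq_zero).2 ?_
  rcases le_or_gt β α with hle | hlt
  · simp [Ioo_eq_empty_of_le hle, Filter.EventuallyEq]
  have hu0 : u =ᵐ[volume.restrict (Icc α β)] fun _ => 0 := by
    rw [← restrict_Ioo_eq_restrict_Icc]
    filter_upwards [e, Lp.coeFn_zero ℂ 2 ((volume : Measure ℝ).restrict (Ioo α β))] with t h1 h2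
    rw [← h1, h2]
    rfl
  have hu : EqOn u (fun _ => 0) (Icc α β) :=
    Measure.eqOn_Icc_of_ae_eq volume hlt.ne hu0 d.continuousOn continuousOn_const
  have hG : ∀ x ∈ Icc α β, ∫ t in α..x, g t = 0 := by
    intro x hx
    have h1 := h x hx
    rw [derivWithin_congr hu (hu hx), derivWithin_fun_const] at h1
    have h2 : ∫ t in α..x, ((V t : ℂ) * u t - g t) = ∫ t in α..x, -g t := by
      refine intervalIntegral.integral_congr fun t ht => ?_
      rw [uIcc_of_le hx.1] at ht
      simp [hu ⟨ht.1, ht.2.trans hx.2⟩]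
    rw [h2, intervalIntegral.integral_neg] at h1
    simpa using h1.symm
  have hgi : IntervalIntegrable g volume α β := by
    rw [intervalIntegrable_iff_integrableOn_Ioo_of_le hlt.le]
    exact (Lp.memLp g).integrable (by norm_num)
  rw [Filter.EventuallyEq, ae_restrict_iff' measurableSet_Ioo]
  filter_upwards [hgi.ae_hasDerivAt_integral] with x hx hxI
  rw [uIcc_of_le hlt.le] at hx
  have h1 := hx (Ioo_subset_Icc_self hxI) α (left_mem_Icc.2 hlt.le)
  have h2 : (fun y => ∫ t in α..y, g t) =ᶠ[nhds x] fun _ => 0 := by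
    filter_upwards [isOpen_Ioo.mem_nhds hxI] with y hy using hG y (Ioo_subset_Icc_self hy)
  exact h1.unique ((hasDerivAt_const x (0 : ℂ)).congr_of_eventuallyEq h2)

/-- So the operator has exactly this graph. -/
theorem neumannOperator_graph (α β : ℝ) (a V : ℝ → ℝ) :
    (neumannOperator α β a V).graph = neumannGraph α β a V :=
  Submodule.toLinearPMap_graph_eq _ (neumannGraph_single_valued α β a V)

/-- The eigenspace `{f ∈ Dom T | T f = μ f}` of an unbounded operator `T`. -/
def LinearPMap.eigenspaceAt {E : Type*} [AddCommGroup E] [Module ℂ E]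
    (T : E →ₗ.[ℂ] E) (μ : ℂ) : Submodule ℂ E :=
  (LinearMap.ker (T.toFun - μ • T.domain.subtype)).map T.domain.subtype

/-- The real sequence `ev 0 ≤ ev 1 ≤ ...` lists all the eigenvalues of `T` in increasing order,
each repeated according to its multiplicity. -/
def IsEigenvalueSequence {E : Type*} [AddCommGroup E] [Module ℂ E]
    (T : E →ₗ.[ℂ] E) (ev : ℕ → ℝ) : Prop :=
  Monotone ev ∧
    ∀ μ : ℂ, {i : ℕ | (ev i : ℂ) = μ}.encard = Cardinal.toENat (Module.rank ℂ (T.eigenspaceAt μ))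

/-! With `b = 1/a` and `v = a u'`, the eigenvalue equation becomes the system `u' = b v`, `v' = (V -
λ) u` with `v = 0` at both ends. Writing `u = r cos θ`, `v = -r sin θ` decouples a scalar equation
for the Prüfer angle, `θ' = b sin² θ + (λ - V) cos² θ` with `θ(α) = 0`, and a real `λ` is an
eigenvalue exactly when `θ(β)` is a multiple of `π`.

The difference of two angles solves a linear equation whose forcing is nonnegative when the
coefficients are ordered, so larger coefficients give a larger angle
(`IsPruferAngle.le_of_coeff_le`). Hence `θ(β)` is strictly increasing and continuous in `λ`, and it
never drops below `-π/2`. Comparison with constant coefficients, whose angle is explicit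
(`isPruferAngle_const`), shows that the value `iπ` is attained between the two claimed bounds, for
each natural `i`; negative multiples of `π` never occur (`SLCoeff.exists_eigenvalues`).

Every solution with `v(α) = 0` is a multiple of one real solution (`SLCoeff.eq_radius_smul`), so
eigenvalues are simple; the Green form excludes nonreal ones. The numbers found therefore form a
strictly increasing eigenvalue sequence, and any other eigenvalue sequence equals it
(`IsEigenvalueSequence.eq_of_strictMono`).

For the separation, the gap between the enclosures of index `i` and `i + 1` is a concave quadratic
in `i`. The two hypotheses on `v₁ - v₀` say that it is nonnegative at `0` and at `M - 1`, hence in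
between (`enclosure_le`). -/

/-! ### Calculus of absolutely continuous functions with almost everywhere derivatives. -/

/-- Composition of an absolutely continuous function with a Lipschitz function. -/
theorem AbsolutelyContinuousOnInterval.comp_lipschitzOnWith {X Y : Type*} [PseudoMetricSpace X]
    [PseudoMetricSpace Y] {f : ℝ → X} {g : X → Y} {s : Set X} {K : NNReal} {a b : ℝ}
    (hf : AbsolutelyContinuousOnInterval f a b) (hg : LipschitzOnWith K g s)
    (hs : MapsTo f (uIcc a b) s) : AbsolutelyContinuousOnInterval (fun x => g (f x)) a b := by
  have h0 : Filter.Tendsto (fun E : ℕ × (ℕ → ℝ × ℝ) =>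
      (K : ℝ) * ∑ i ∈ Finset.range E.1, dist (f (E.2 i).1) (f (E.2 i).2))
      (AbsolutelyContinuousOnInterval.totalLengthFilter ⊓
        Filter.principal (AbsolutelyContinuousOnInterval.disjWithin a b)) (nhds 0) := by
    simpa using Filter.Tendsto.const_mul (K : ℝ) hf
  refine squeeze_zero' (Filter.Eventually.of_forall fun E =>
    Finset.sum_nonneg fun i _ => dist_nonneg) ?_ h0
  rw [Filter.eventually_inf_principal]
  refine Filter.Eventually.of_forall fun E hE => ?_
  rw [Finset.mul_sum]
  refine Finset.sum_le_sum fun i hi => ?_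
  exact hg.dist_le_mul _ (hs (hE.1 i hi).1) _ (hs (hE.1 i hi).2)

/-- An absolutely continuous function is bounded, and a `C¹` function is Lipschitz on a compact
interval containing its values. -/
theorem AbsolutelyContinuousOnInterval.comp_contDiff {E : Type*} [NormedAddCommGroup E]
    [NormedSpace ℝ E] {f : ℝ → ℝ} {g : ℝ → E} {a b : ℝ}
    (hf : AbsolutelyContinuousOnInterval f a b) (hg : ContDiff ℝ 1 g) :
    AbsolutelyContinuousOnInterval (fun x => g (f x)) a b := by
  obtain ⟨C, hC⟩ := hf.exists_bound
  obtain ⟨K, hK⟩ := (hg.contDiffOn (s := Icc (-C) C)).exists_lipschitzOnWith (by decide)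
    (convex_Icc _ _) isCompact_Icc
  exact hf.comp_lipschitzOnWith hK fun x hx => abs_le.1 (hC x hx)

/-- `f` is absolutely continuous on the interval between `a` and `b`, with derivative `f'` almost
everywhere. -/
structure HasACDeriv {E : Type*} [NormedAddCommGroup E] [NormedSpace ℝ E] (f f' : ℝ → E)
    (a b : ℝ) : Prop where
  ac : AbsolutelyContinuousOnInterval f a b
  ae : ∀ᵐ x, x ∈ uIcc a b → HasDerivAt f (f' x) x

namespace HasACDeriv

variable {E : Type*} [NormedAddCommGroup E] [NormedSpace ℝ E] {f f' g g' : ℝ → E} {a b : ℝ}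

theorem congr_ae (hf : HasACDeriv f f' a b) (h : ∀ᵐ x, x ∈ uIcc a b → f' x = g' x) :
    HasACDeriv f g' a b :=
  ⟨hf.ac, by filter_upwards [hf.ae, h] with x h1 h2 hx using h2 hx ▸ h1 hx⟩

theorem congr_deriv (hf : HasACDeriv f f' a b) (h : ∀ x ∈ uIcc a b, f' x = g' x) :
    HasACDeriv f g' a b :=
  hf.congr_ae (Filter.Eventually.of_forall h)

theorem mono {c d : ℝ} (hf : HasACDeriv f f' a b) (h : uIcc c d ⊆ uIcc a b) :
    HasACDeriv f f' c d :=
  ⟨hf.ac.mono h, by filter_upwards [hf.ae] with x h1 hx using h1 (h hx)⟩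

theorem add (hf : HasACDeriv f f' a b) (hg : HasACDeriv g g' a b) :
    HasACDeriv (fun x => f x + g x) (fun x => f' x + g' x) a b :=
  ⟨hf.ac.add hg.ac, by filter_upwards [hf.ae, hg.ae] with x h1 h2 hx using (h1 hx).add (h2 hx)⟩

theorem sub (hf : HasACDeriv f f' a b) (hg : HasACDeriv g g' a b) :
    HasACDeriv (fun x => f x - g x) (fun x => f' x - g' x) a b :=
  ⟨hf.ac.sub hg.ac, by filter_upwards [hf.ae, hg.ae] with x h1 h2 hx using (h1 hx).sub (h2 hx)⟩

theorem neg (hf : HasACDeriv f f' a b) : HasACDeriv (fun x => -f x) (fun x => -f' x) a b :=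
  ⟨hf.ac.neg, by filter_upwards [hf.ae] with x h1 hx using (h1 hx).neg⟩

theorem smul {r r' : ℝ → ℝ} (hr : HasACDeriv r r' a b) (hf : HasACDeriv f f' a b) :
    HasACDeriv (fun x => r x • f x) (fun x => r x • f' x + r' x • f x) a b :=
  ⟨hr.ac.smul hf.ac, by
    filter_upwards [hr.ae, hf.ae] with x h1 h2 hx using (h1 hx).smul (h2 hx)⟩

theorem mul {r r' s s' : ℝ → ℝ} (hr : HasACDeriv r r' a b) (hs : HasACDeriv s s' a b) :
    HasACDeriv (fun x => r x * s x) (fun x => r x * s' x + r' x * s x) a b :=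
  hr.smul hs

theorem comp {r r' : ℝ → ℝ} (hr : HasACDeriv r r' a b) {G : ℝ → E} (hG : ContDiff ℝ 1 G) :
    HasACDeriv (fun x => G (r x)) (fun x => r' x • deriv G (r x)) a b :=
  ⟨hr.ac.comp_contDiff hG, by
    filter_upwards [hr.ae] with x h1 hx
    exact ((hG.differentiable (by norm_num)) (r x)).hasDerivAt.scomp x (h1 hx)⟩

theorem sin {r r' : ℝ → ℝ} (hr : HasACDeriv r r' a b) :
    HasACDeriv (fun x => Real.sin (r x)) (fun x => r' x * Real.cos (r x)) a b := by
  simpa using hr.comp Real.contDiff_sin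

theorem cos {r r' : ℝ → ℝ} (hr : HasACDeriv r r' a b) :
    HasACDeriv (fun x => Real.cos (r x)) (fun x => -(r' x * Real.sin (r x))) a b := by
  simpa using hr.comp Real.contDiff_cos

theorem exp {r r' : ℝ → ℝ} (hr : HasACDeriv r r' a b) :
    HasACDeriv (fun x => Real.exp (r x)) (fun x => r' x * Real.exp (r x)) a b := by
  simpa using hr.comp Real.contDiff_exp

theorem clm_comp {F : Type*} [NormedAddCommGroup F] [NormedSpace ℝ F] (L : E →L[ℝ] F)
    (hf : HasACDeriv f f' a b) : HasACDeriv (fun x => L (f x)) (fun x => L (f' x)) a b :=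
  ⟨hf.ac.comp_lipschitzOnWith (L.lipschitz.lipschitzOnWith (s := univ)) (mapsTo_univ _ _), by
    filter_upwards [hf.ae] with x h1 hx using L.hasFDerivAt.comp_hasDerivAt x (h1 hx)⟩

theorem of_hasDerivAt_contDiff (hf : ContDiff ℝ 1 f) (h : ∀ x, HasDerivAt f (f' x) x) :
    HasACDeriv f f' a b :=
  ⟨hf.contDiffOn.absolutelyContinuousOnInterval, Filter.Eventually.of_forall fun x _ => h x⟩

theorem const (c : E) : HasACDeriv (fun _ => c) (fun _ => 0) a b :=
  of_hasDerivAt_contDiff contDiff_const fun x => hasDerivAt_const x c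

theorem eq_of_deriv_eq_zero (hf : HasACDeriv f (fun _ => 0) a b) {x y : ℝ} (hx : x ∈ uIcc a b)
    (hy : y ∈ uIcc a b) : f x = f y := by
  obtain ⟨C, hC⟩ := hf.ac.const_of_ae_hasDerivAt_zero hf.ae
  rw [hC x hx, hC y hy]

theorem deriv_ae {r r' : ℝ → ℝ} (hr : HasACDeriv r r' a b) :
    ∀ᵐ x, x ∈ uIoc a b → deriv r x = r' x := by
  filter_upwards [hr.ae] with x h1 hx using (h1 (uIoc_subset_uIcc hx)).deriv

theorem integral_eq_sub {r r' : ℝ → ℝ} (hr : HasACDeriv r r' a b) :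
    ∫ x in a..b, r' x = r b - r a := by
  rw [← hr.ac.integral_deriv_eq_sub]
  refine intervalIntegral.integral_congr_ae ?_
  filter_upwards [hr.deriv_ae] with x h1 hx using (h1 hx).symm

theorem monotoneOn {r r' : ℝ → ℝ} (hr : HasACDeriv r r' a b)
    (h : ∀ᵐ x, x ∈ uIcc a b → 0 ≤ r' x) : MonotoneOn r (uIcc a b) := by
  intro x hx y hy hxy
  have hsub : uIcc x y ⊆ uIcc a b := uIcc_subset_uIcc hx hy
  have h1 := (hr.mono hsub).integral_eq_sub
  have h2 : 0 ≤ ∫ t in x..y, r' t := by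
    refine intervalIntegral.integral_nonneg_of_ae_restrict hxy ?_
    rw [Filter.EventuallyLE, ae_restrict_iff' measurableSet_Icc]
    filter_upwards [h] with t ht hxt
    exact ht (hsub (by rwa [uIcc_of_le hxy]))
  linarith

theorem abs_sub_le {r r' : ℝ → ℝ} (hr : HasACDeriv r r' a b) {C : ℝ}
    (h : ∀ᵐ x, x ∈ uIcc a b → |r' x| ≤ C) : |r b - r a| ≤ C * |b - a| := by
  rw [← hr.integral_eq_sub, ← Real.norm_eq_abs]
  refine intervalIntegral.norm_integral_le_of_norm_le_const_ae ?_
  filter_upwards [h] with x hx hx' using hx (uIoc_subset_uIcc hx')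

end HasACDeriv

/-! ### Primitives and linear first order equations. -/

theorem lipschitzOnWith_intervalIntegral {E : Type*} [NormedAddCommGroup E] [NormedSpace ℝ E]
    {F : ℝ → E} {a b C : ℝ} (hC : 0 ≤ C) (hF : IntervalIntegrable F volume a b)
    (h : ∀ᵐ x, x ∈ uIcc a b → ‖F x‖ ≤ C) :
    LipschitzOnWith C.toNNReal (fun x => ∫ t in a..x, F t) (uIcc a b) := by
  refine LipschitzOnWith.of_dist_le_mul fun x hx y hy => ?_
  have hsub : ∀ {z w}, z ∈ uIcc a b → w ∈ uIcc a b → uIcc z w ⊆ uIcc a b :=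
    fun hz hw => uIcc_subset_uIcc hz hw
  rw [dist_eq_norm, intervalIntegral.integral_interval_sub_left
    (hF.mono_set (hsub left_mem_uIcc hx)) (hF.mono_set (hsub left_mem_uIcc hy)),
    Real.coe_toNNReal _ hC, Real.dist_eq]
  refine intervalIntegral.norm_integral_le_of_norm_le_const_ae ?_
  filter_upwards [h] with t ht htx using ht (hsub hy hx (uIoc_subset_uIcc htx))

theorem hasACDeriv_intervalIntegral {E : Type*} [NormedAddCommGroup E] [NormedSpace ℝ E]
    [CompleteSpace E] {F : ℝ → E} {a b C : ℝ} (hC : 0 ≤ C) (hF : IntervalIntegrable F volume a b)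
    (h : ∀ᵐ x, x ∈ uIcc a b → ‖F x‖ ≤ C) :
    HasACDeriv (fun x => ∫ t in a..x, F t) F a b := by
  refine ⟨(lipschitzOnWith_intervalIntegral hC hF h).absolutelyContinuousOnInterval, ?_⟩
  filter_upwards [hF.ae_hasDerivAt_integral] with x hx hxI using hx hxI a left_mem_uIcc

theorem intervalIntegrable_of_measurable_of_bound {k : ℝ → ℝ} {K : ℝ} (hk : Measurable k)
    (hK : ∀ x, |k x| ≤ K) (a b : ℝ) : IntervalIntegrable k volume a b :=
  (intervalIntegrable_const (c := K)).mono_fun hk.aestronglyMeasurable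
    (Filter.Eventually.of_forall fun x => by
      simpa using (hK x).trans (le_abs_self K))

theorem hasACDeriv_primitive {k : ℝ → ℝ} {K : ℝ} (hk : Measurable k) (hK : ∀ x, |k x| ≤ K)
    (a b : ℝ) : HasACDeriv (fun x => ∫ t in a..x, k t) k a b :=
  hasACDeriv_intervalIntegral ((abs_nonneg _).trans (hK 0))
    (intervalIntegrable_of_measurable_of_bound hk hK a b)
    (Filter.Eventually.of_forall fun x _ => hK x)

theorem abs_primitive_le {k : ℝ → ℝ} {K : ℝ} (hK : ∀ x, |k x| ≤ K) (a x : ℝ) :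
    |∫ t in a..x, k t| ≤ K * |x - a| :=
  (Real.norm_eq_abs _).symm.trans_le
    (intervalIntegral.norm_integral_le_of_norm_le_const fun t _ => hK t)

/-- Integrating factor for a linear first order equation `w' = k w + g`. -/
theorem HasACDeriv.integratingFactor {E : Type*} [NormedAddCommGroup E] [NormedSpace ℝ E]
    {w g : ℝ → E} {k : ℝ → ℝ} {K a b : ℝ} (hk : Measurable k) (hK : ∀ x, |k x| ≤ K)
    (hw : HasACDeriv w (fun x => k x • w x + g x) a b) :
    HasACDeriv (fun x => Real.exp (-∫ t in a..x, k t) • w x)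
      (fun x => Real.exp (-∫ t in a..x, k t) • g x) a b := by
  refine ((hasACDeriv_primitive hk hK a b).neg.exp.smul hw).congr_deriv fun x _ => ?_
  simp only [smul_add, smul_smul, neg_mul, neg_smul]
  rw [mul_comm (k x)]
  abel

/-- The solutions of `w' = k w` are the multiples of the exponential of the primitive of `k`. -/
theorem HasACDeriv.eq_exp_smul {E : Type*} [NormedAddCommGroup E] [NormedSpace ℝ E]
    {w : ℝ → E} {k : ℝ → ℝ} {K a b : ℝ} (hk : Measurable k) (hK : ∀ x, |k x| ≤ K)
    (hw : HasACDeriv w (fun x => k x • w x) a b) {x : ℝ} (hx : x ∈ uIcc a b) :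
    w x = Real.exp (∫ t in a..x, k t) • w a := by
  have hw' : HasACDeriv w (fun x => k x • w x + (0 : E)) a b := by simpa using hw
  have h := hw'.integratingFactor hk hK
  simp only [smul_zero] at h
  have h1 := h.eq_of_deriv_eq_zero hx left_mem_uIcc
  simp only [intervalIntegral.integral_same, neg_zero, Real.exp_zero, one_smul] at h1
  rw [← h1, smul_smul, ← Real.exp_add]
  simp

/-- Comparison: `w' = k w + g` with `g ≥ 0` and `w a ≥ 0`. -/
theorem HasACDeriv.nonneg_of_linear {w g k : ℝ → ℝ} {K a b : ℝ} (hab : a ≤ b)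
    (hk : Measurable k) (hK : ∀ x, |k x| ≤ K)
    (hw : HasACDeriv w (fun x => k x * w x + g x) a b) (hg : ∀ᵐ x, x ∈ Icc a b → 0 ≤ g x)
    (ha : 0 ≤ w a) :
    (∀ x ∈ Icc a b, 0 ≤ w x) ∧ (w b = 0 → ∀ x ∈ Icc a b, w x = 0) := by
  have h := HasACDeriv.integratingFactor (E := ℝ) hk hK hw
  have hm := h.monotoneOn (by
    rw [uIcc_of_le hab]
    filter_upwards [hg] with x h1 hx using mul_nonneg (Real.exp_pos _).le (h1 hx))
  rw [uIcc_of_le hab] at hm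
  have hpos : ∀ x ∈ Icc a b, 0 ≤ w x := by
    intro x hx
    have h1 := hm (left_mem_Icc.2 hab) hx hx.1
    simp only [intervalIntegral.integral_same, neg_zero, Real.exp_zero, smul_eq_mul,
      one_mul] at h1
    exact (mul_nonneg_iff_of_pos_left (Real.exp_pos _)).1 (ha.trans h1)
  -- The function `exp(-∫k) w` is nondecreasing and nonnegative, so if it vanishes at the right end
  -- it vanishes throughout.
  refine ⟨hpos, fun hb x hx => le_antisymm ?_ (hpos x hx)⟩
  have h1 := hm hx (right_mem_Icc.2 hab) hx.2
  simp only [hb, smul_eq_mul, mul_zero] at h1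
  by_contra! hc
  exact absurd (mul_pos (Real.exp_pos _) hc) (not_lt.2 h1)

/-- Growth bound for `w' = k w + g`, `w a = 0`. -/
theorem HasACDeriv.abs_le_of_linear {w g k : ℝ → ℝ} {K G a b : ℝ} (hab : a ≤ b)
    (hk : Measurable k) (hK : ∀ x, |k x| ≤ K)
    (hw : HasACDeriv w (fun x => k x * w x + g x) a b) (hg : ∀ x, |g x| ≤ G)
    (ha : w a = 0) : |w b| ≤ Real.exp (2 * K * (b - a)) * G * (b - a) := by
  have hK0 : 0 ≤ K := (abs_nonneg _).trans (hK 0)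
  have hJ : ∀ x ∈ Icc a b, |∫ t in a..x, k t| ≤ K * (b - a) := fun x hx =>
    (abs_primitive_le hK a x).trans (by
      rw [abs_of_nonneg (by linarith [hx.1])]
      exact mul_le_mul_of_nonneg_left (by linarith [hx.2]) hK0)
  have h := HasACDeriv.integratingFactor (E := ℝ) hk hK hw
  -- The factor `2K` in the final exponent arises because the integrating factor costs `exp(K(b -
  -- a))` twice: once on the forcing here, once when it is removed from `w b`.
  have h1 := h.abs_sub_le (C := Real.exp (K * (b - a)) * G) (by
    refine Filter.Eventually.of_forall fun x hx => ?_
    rw [uIcc_of_le hab] at hx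
    rw [smul_eq_mul, abs_mul, Real.abs_exp]
    gcongr
    · exact (neg_le_abs _).trans (hJ x hx)
    · exact hg x)
  rw [ha, smul_zero, sub_zero, smul_eq_mul, abs_mul, Real.abs_exp,
    abs_of_nonneg (sub_nonneg.2 hab)] at h1
  have h2 : |w b| = Real.exp (∫ t in a..b, k t) * (Real.exp (-∫ t in a..b, k t) * |w b|) := by
    rw [← mul_assoc, ← Real.exp_add]
    simp
  have h3 : Real.exp (∫ t in a..b, k t) ≤ Real.exp (K * (b - a)) :=
    Real.exp_le_exp.2 ((le_abs_self _).trans (hJ b (right_mem_Icc.2 hab)))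
  calc |w b| ≤ Real.exp (K * (b - a)) * (Real.exp (K * (b - a)) * G * (b - a)) := by
        rw [h2]
        exact mul_le_mul h3 h1 (by positivity) (Real.exp_pos _).le
    _ = Real.exp (2 * K * (b - a)) * G * (b - a) := by
        rw [← mul_assoc, ← mul_assoc, ← Real.exp_add]
        ring_nf

/-! ### Existence for Carathéodory equations. -/

/-- Global existence for a Carathéodory equation `θ' = F(x, θ)` with bounded, uniformly Lipschitz
right-hand side. -/
theorem exists_caratheodory_solution {F : ℝ → ℝ → ℝ} {C K a b : ℝ} (hab : a ≤ b) (hK : 0 < K)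
    (hm : ∀ y : ℝ → ℝ, Continuous y → Measurable fun x => F x (y x))
    (hC : ∀ x s, |F x s| ≤ C) (hL : ∀ x s t, |F x s - F x t| ≤ K * |s - t|) :
    ∃ θ : ℝ → ℝ, Continuous θ ∧ θ a = 0 ∧ HasACDeriv θ (fun x => F x (θ x)) a b := by
  -- A point `y` of the function space stands for the candidate `exp(2K(s - a)) y(s)`, with `y`
  -- extended by its endpoint values. In this weighted (Bielecki) norm the Picard map contracts by
  -- `1/2` on the whole interval, whatever its length.
  let ext : C(Icc a b, ℝ) → ℝ → ℝ := fun y s => Real.exp (2 * K * (s - a)) * y (projIcc a b hab s)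
  have hext : ∀ y, Continuous (ext y) := fun y => by
    have := (y.continuous.comp (continuous_projIcc (h := hab)))
    exact (by fun_prop : Continuous fun s : ℝ => Real.exp (2 * K * (s - a))).mul this
  let θ : C(Icc a b, ℝ) → ℝ → ℝ := fun y x => ∫ s in a..x, F s (ext y s)
  have hint : ∀ y c d, IntervalIntegrable (fun s => F s (ext y s)) volume c d := fun y c d =>
    intervalIntegrable_of_measurable_of_bound (hm _ (hext y)) (fun x => hC x _) c d
  have hθ : ∀ y, Continuous (θ y) := fun y =>
    intervalIntegral.continuous_primitive (hint y) a
  let S : C(Icc a b, ℝ) → C(Icc a b, ℝ) := fun y =>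
    ⟨fun t => Real.exp (-(2 * K * (t - a))) * θ y t, by
      have := (hθ y).comp (continuous_subtype_val (p := fun x => x ∈ Icc a b))
      exact (by fun_prop : Continuous fun t : Icc a b => Real.exp (-(2 * K * ((t : ℝ) - a)))).mul
        this⟩
  have hS : ContractingWith (1 / 2) S := by
    refine ⟨by rw [← NNReal.coe_lt_coe]; norm_num, LipschitzWith.of_dist_le_mul fun y z => ?_⟩
    rw [ContinuousMap.dist_le (by positivity)]
    intro t
    have ht := t.2
    have hcont : Continuous fun s : ℝ => K * Real.exp (2 * K * (s - a)) * dist y z := by fun_prop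
    have hprim : ∫ s in a..(t : ℝ), K * Real.exp (2 * K * (s - a)) * dist y z =
        (Real.exp (2 * K * (t - a)) - 1) / 2 * dist y z := by
      have hd : ∀ s, HasDerivAt (fun s => Real.exp (2 * K * (s - a)) / 2 * dist y z)
          (K * Real.exp (2 * K * (s - a)) * dist y z) s := fun s => by
        have h1 : HasDerivAt (fun s : ℝ => 2 * K * (s - a)) (2 * K * 1) s :=
          ((hasDerivAt_id s).sub_const a).const_mul _
        exact ((h1.exp.div_const 2).mul_const (dist y z)).congr_deriv (by ring)
      rw [intervalIntegral.integral_eq_sub_of_hasDerivAt (fun s _ => hd s)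
        (hcont.intervalIntegrable _ _)]
      simp only [sub_self, mul_zero, Real.exp_zero]
      ring
    have hle : |θ y t - θ z t| ≤ (Real.exp (2 * K * (t - a)) - 1) / 2 * dist y z := by
      rw [← hprim, ← intervalIntegral.integral_sub (hint y _ _) (hint z _ _), ← Real.norm_eq_abs]
      refine intervalIntegral.norm_integral_le_of_norm_le ht.1
        (Filter.Eventually.of_forall fun s hs => ?_) (hcont.intervalIntegrable _ _)
      refine (hL s _ _).trans ?_
      rw [mul_assoc]
      refine mul_le_mul_of_nonneg_left ?_ hK.le
      rw [← mul_sub, abs_mul, Real.abs_exp]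
      exact mul_le_mul_of_nonneg_left
        ((Real.dist_eq _ _).symm.trans_le (ContinuousMap.dist_apply_le_dist _)) (Real.exp_pos _).le
    change dist (Real.exp (-(2 * K * (t - a))) * θ y t) (Real.exp (-(2 * K * (t - a))) * θ z t) ≤ _
    rw [Real.dist_eq, ← mul_sub, abs_mul, Real.abs_exp]
    have he : Real.exp (-(2 * K * (t - a))) * Real.exp (2 * K * (t - a)) = 1 := by
      rw [← Real.exp_add]
      simp
    calc _ ≤ Real.exp (-(2 * K * (t - a))) *
          ((Real.exp (2 * K * (t - a)) - 1) / 2 * dist y z) :=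
          mul_le_mul_of_nonneg_left hle (Real.exp_pos _).le
      _ = (1 - Real.exp (-(2 * K * (t - a)))) / 2 * dist y z := by
        linear_combination (dist y z / 2) * he
      _ ≤ _ := by
        push_cast
        refine mul_le_mul_of_nonneg_right ?_ dist_nonneg
        linarith [Real.exp_pos (-(2 * K * ((t : ℝ) - a)))]
  obtain ⟨y, hy⟩ : ∃ y, S y = y := by
    have : Nonempty C(Icc a b, ℝ) := ⟨0⟩
    exact ⟨_, hS.fixedPoint_isFixedPt⟩
  refine ⟨θ y, hθ y, intervalIntegral.integral_same, ?_⟩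
  refine (hasACDeriv_primitive (hm _ (hext y)) (fun x => hC x _) a b).congr_deriv fun x hx => ?_
  rw [uIcc_of_le hab] at hx
  congr 1
  have h1 : S y ⟨x, hx⟩ = y ⟨x, hx⟩ := by rw [hy]
  change Real.exp (-(2 * K * (x - a))) * θ y x = y ⟨x, hx⟩ at h1
  change Real.exp (2 * K * (x - a)) * y (projIcc a b hab x) = _
  rw [projIcc_of_mem hab hx, ← h1, ← mul_assoc, ← Real.exp_add]
  simp

/-! ### Prüfer angles and their comparison. -/

/-- `θ` is a Prüfer angle for the system `u' = b v`, `v' = -q u` on `[α, β]`: up to a positive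
factor, `u = cos θ` and `v = - sin θ`. -/
structure IsPruferAngle (b q θ : ℝ → ℝ) (α β : ℝ) : Prop where
  continuous : Continuous θ
  hasACDeriv : HasACDeriv θ (fun x => b x * Real.sin (θ x) ^ 2 + q x * Real.cos (θ x) ^ 2) α β

/-- Using `sinc` extracts the factor `A - B` without dividing by it, so the quotient stays
continuous and bounded by `1`. This serves both for the Lipschitz bound on the angle equation and
for linearising the difference of two angles. -/
theorem Real.sin_sq_sub_sin_sq_eq_sinc (A B : ℝ) :
    Real.sin A ^ 2 - Real.sin B ^ 2 = Real.sin (A + B) * Real.sinc (A - B) * (A - B) := by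
  have h : Real.sinc (A - B) * (A - B) = Real.sin (A - B) := by
    rcases eq_or_ne (A - B) 0 with h | h
    · simp [h]
    · rw [Real.sinc_of_ne_zero h, div_mul_cancel₀ _ h]
  rw [mul_assoc, h, Real.sin_add, Real.sin_sub]
  linear_combination Real.sin B ^ 2 * Real.sin_sq_add_cos_sq A -
    Real.sin A ^ 2 * Real.sin_sq_add_cos_sq B

theorem exists_isPruferAngle {b q : ℝ → ℝ} {B C α β : ℝ} (hαβ : α ≤ β) (hb : Measurable b)
    (hq : Measurable q) (hB : ∀ x, |b x| ≤ B) (hC : ∀ x, |q x| ≤ C) :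
    ∃ θ, IsPruferAngle b q θ α β ∧ θ α = 0 := by
  have hB0 : 0 ≤ B := (abs_nonneg _).trans (hB 0)
  have hC0 : 0 ≤ C := (abs_nonneg _).trans (hC 0)
  obtain ⟨θ, h1, h2, h3⟩ := exists_caratheodory_solution
    -- The Lipschitz constant `B + C` would suffice; the extra `1` makes it positive.
    (F := fun x s => b x * Real.sin s ^ 2 + q x * Real.cos s ^ 2) (C := B + C) (K := B + C + 1)
    hαβ (by positivity)
    (fun y hy => by
      have := hy.measurable
      fun_prop)
    (fun x s => by
      refine (abs_add_le _ _).trans ?_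
      rw [abs_mul, abs_mul, abs_of_nonneg (sq_nonneg (Real.sin s)),
        abs_of_nonneg (sq_nonneg (Real.cos s))]
      exact add_le_add
        ((mul_le_of_le_one_right (abs_nonneg _) (Real.sin_sq_le_one s)).trans (hB x))
        ((mul_le_of_le_one_right (abs_nonneg _) (Real.cos_sq_le_one s)).trans (hC x)))
    (fun x s t => by
      have h : b x * Real.sin s ^ 2 + q x * Real.cos s ^ 2 -
          (b x * Real.sin t ^ 2 + q x * Real.cos t ^ 2) =
          (b x - q x) * (Real.sin (s + t) * Real.sinc (s - t)) * (s - t) := by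
        rw [mul_assoc, ← Real.sin_sq_sub_sin_sq_eq_sinc, Real.cos_sq', Real.cos_sq']
        ring
      rw [h, abs_mul]
      refine mul_le_mul_of_nonneg_right ?_ (abs_nonneg _)
      rw [abs_mul, abs_mul]
      have h1 : |b x - q x| ≤ B + C := (abs_sub _ _).trans (add_le_add (hB x) (hC x))
      have h2 : |Real.sin (s + t)| * |Real.sinc (s - t)| ≤ 1 :=
        mul_le_one₀ (Real.abs_sin_le_one _) (abs_nonneg _) (Real.abs_sinc_le_one _)
      calc _ ≤ (B + C) * 1 := mul_le_mul h1 h2 (by positivity) (by positivity)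
        _ ≤ _ := by linarith)
  exact ⟨θ, ⟨h1, h3⟩, h2⟩

namespace IsPruferAngle

variable {b b₁ b₂ q q₁ q₂ θ ψ : ℝ → ℝ} {K α β : ℝ}

/-- The coefficient of the linear equation satisfied by the difference of two Prüfer angles. -/
noncomputable def diffCoeff (b q θ ψ : ℝ → ℝ) (x : ℝ) : ℝ :=
  (b x - q x) * (Real.sin (ψ x + θ x) * Real.sinc (ψ x - θ x))

theorem measurable_diffCoeff (hb : Measurable b) (hq : Measurable q) (hθ : Continuous θ)
    (hψ : Continuous ψ) : Measurable (diffCoeff b q θ ψ) :=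
  (hb.sub hq).mul ((Real.continuous_sin.comp (hψ.add hθ)).mul
    (Real.continuous_sinc.comp (hψ.sub hθ))).measurable

theorem abs_diffCoeff_le (hK : ∀ x, |b x - q x| ≤ K) (x : ℝ) : |diffCoeff b q θ ψ x| ≤ K := by
  rw [diffCoeff, abs_mul, abs_mul]
  have h2 : |Real.sin (ψ x + θ x)| * |Real.sinc (ψ x - θ x)| ≤ 1 :=
    mul_le_one₀ (Real.abs_sin_le_one _) (abs_nonneg _) (Real.abs_sinc_le_one _)
  exact (mul_le_of_le_one_right (abs_nonneg _) h2).trans (hK x)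

/-- The nonlinear equations become a linear one for the difference: its coefficient is bounded and
measurable, and the remaining forcing is nonnegative as soon as `b₁ ≤ b₂` and `q₁ ≤ q₂`. -/
theorem hasACDeriv_sub (h₁ : IsPruferAngle b₁ q₁ θ α β) (h₂ : IsPruferAngle b₂ q₂ ψ α β) :
    HasACDeriv (fun x => ψ x - θ x) (fun x => diffCoeff b₁ q₁ θ ψ x * (ψ x - θ x) +
      ((b₂ x - b₁ x) * Real.sin (ψ x) ^ 2 + (q₂ x - q₁ x) * Real.cos (ψ x) ^ 2)) α β := by
  refine (h₂.hasACDeriv.sub h₁.hasACDeriv).congr_deriv fun x _ => ?_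
  rw [diffCoeff, mul_assoc, ← Real.sin_sq_sub_sin_sq_eq_sinc, Real.cos_sq', Real.cos_sq']
  ring

/-- Comparison of Prüfer angles. -/
theorem le_of_coeff_le (hαβ : α ≤ β) (h₁ : IsPruferAngle b₁ q₁ θ α β)
    (h₂ : IsPruferAngle b₂ q₂ ψ α β) (hb : Measurable b₁) (hq : Measurable q₁)
    (hK : ∀ x, |b₁ x - q₁ x| ≤ K) (hb₁₂ : ∀ x, b₁ x ≤ b₂ x) (hq₁₂ : ∀ x, q₁ x ≤ q₂ x)
    (hα : θ α ≤ ψ α) :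
    (∀ x ∈ Icc α β, θ x ≤ ψ x) ∧ (θ β = ψ β → ∀ x ∈ Icc α β, ψ x = θ x) := by
  have h := (hasACDeriv_sub h₁ h₂).nonneg_of_linear hαβ
    (measurable_diffCoeff hb hq h₁.continuous h₂.continuous) (abs_diffCoeff_le hK)
    (Filter.Eventually.of_forall fun x _ => add_nonneg
      (mul_nonneg (sub_nonneg.2 (hb₁₂ x)) (sq_nonneg _))
      (mul_nonneg (sub_nonneg.2 (hq₁₂ x)) (sq_nonneg _))) (sub_nonneg.2 hα)
  exact ⟨fun x hx => sub_nonneg.1 (h.1 x hx),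
    fun he x hx => sub_eq_zero.1 (h.2 (sub_eq_zero.2 he.symm) x hx)⟩

end IsPruferAngle

/-! ### The explicit angle for constant coefficients. -/

/-- The change of Prüfer angle under rescaling `v` by the factor `ρ`. -/
noncomputable def pruferRescale (ρ t : ℝ) : ℝ :=
  t + Real.arctan ((ρ - 1) * Real.sin t * Real.cos t / (Real.cos t ^ 2 + ρ * Real.sin t ^ 2))

/-- For `ρ > 0`, `pruferRescale ρ` is the continuous branch of `arctan (ρ tan t)` fixing `0`: the
arctangent in it is the argument of `(cos t + iρ sin t)(cos t - i sin t)`, whose real part is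
positive. Fixing the multiples of `π` makes the comparison angle of frequency `iπ/(β - α)` equal to
exactly `iπ` at `β`. -/
theorem pruferRescale_nat_mul_pi (ρ : ℝ) (n : ℕ) :
    pruferRescale ρ (n * Real.pi) = n * Real.pi := by
  simp [pruferRescale, Real.sin_nat_mul_pi]

section Rescale

variable {ρ : ℝ}

theorem cos_sq_add_mul_sin_sq_pos (hρ : 0 < ρ) (t : ℝ) :
    0 < Real.cos t ^ 2 + ρ * Real.sin t ^ 2 := by
  have h := Real.sin_sq_add_cos_sq t
  rcases eq_or_ne (Real.sin t) 0 with hs | hs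
  · rw [hs] at h ⊢
    linarith
  · positivity

theorem contDiff_pruferRescale (hρ : 0 < ρ) : ContDiff ℝ 1 (pruferRescale ρ) := by
  refine contDiff_id.add (Real.contDiff_arctan.comp ?_)
  exact ContDiff.div (by fun_prop) (by fun_prop) fun t => (cos_sq_add_mul_sin_sq_pos hρ t).ne'

/-- Both sides are the squared modulus of `(cos t + iρ sin t)(cos t - i sin t)`. -/
theorem pruferRescale_sq_identity (t : ℝ) :
    (Real.cos t ^ 2 + ρ * Real.sin t ^ 2) ^ 2 + ((ρ - 1) * Real.sin t * Real.cos t) ^ 2 =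
      Real.cos t ^ 2 + ρ ^ 2 * Real.sin t ^ 2 := by
  linear_combination (Real.cos t ^ 2 + ρ ^ 2 * Real.sin t ^ 2) * Real.sin_sq_add_cos_sq t

theorem cos_sq_pruferRescale (hρ : 0 < ρ) (t : ℝ) :
    Real.cos (pruferRescale ρ t) ^ 2 =
      Real.cos t ^ 2 / (Real.cos t ^ 2 + ρ ^ 2 * Real.sin t ^ 2) := by
  have hD := cos_sq_add_mul_sin_sq_pos hρ t
  have hD2 := cos_sq_add_mul_sin_sq_pos (pow_pos hρ 2) t
  have hid := pruferRescale_sq_identity (ρ := ρ) t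
  rw [pruferRescale]
  set z := (ρ - 1) * Real.sin t * Real.cos t / (Real.cos t ^ 2 + ρ * Real.sin t ^ 2) with hz
  have hs : Real.sin (Real.arctan z) = z * Real.cos (Real.arctan z) := by
    rw [← Real.tan_mul_cos (Real.cos_arctan_pos z).ne', Real.tan_arctan]
  have h1 : Real.cos t - Real.sin t * z =
      Real.cos t / (Real.cos t ^ 2 + ρ * Real.sin t ^ 2) := by
    rw [hz, eq_div_iff hD.ne', sub_mul, mul_assoc, div_mul_cancel₀ _ hD.ne']
    linear_combination Real.cos t * Real.sin_sq_add_cos_sq t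
  have h2 : 1 + z ^ 2 = (Real.cos t ^ 2 + ρ ^ 2 * Real.sin t ^ 2) /
      (Real.cos t ^ 2 + ρ * Real.sin t ^ 2) ^ 2 := by
    rw [hz, ← hid]
    field_simp
  calc Real.cos (t + Real.arctan z) ^ 2
      = Real.cos (Real.arctan z) ^ 2 * (Real.cos t - Real.sin t * z) ^ 2 := by
        rw [Real.cos_add, hs]
        ring
    _ = _ := by
        rw [Real.cos_sq_arctan, h1, h2]
        field_simp

theorem sin_sq_pruferRescale (hρ : 0 < ρ) (t : ℝ) :
    Real.sin (pruferRescale ρ t) ^ 2 =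
      ρ ^ 2 * Real.sin t ^ 2 / (Real.cos t ^ 2 + ρ ^ 2 * Real.sin t ^ 2) := by
  have hD2 := cos_sq_add_mul_sin_sq_pos (pow_pos hρ 2) t
  rw [Real.sin_sq, cos_sq_pruferRescale hρ]
  field_simp
  ring

theorem hasDerivAt_pruferRescale (hρ : 0 < ρ) (t : ℝ) :
    HasDerivAt (pruferRescale ρ) (ρ / (Real.cos t ^ 2 + ρ ^ 2 * Real.sin t ^ 2)) t := by
  have hD := cos_sq_add_mul_sin_sq_pos hρ t
  have hD2 := cos_sq_add_mul_sin_sq_pos (pow_pos hρ 2) t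
  have hid := pruferRescale_sq_identity (ρ := ρ) t
  have hs := Real.hasDerivAt_sin t
  have hc := Real.hasDerivAt_cos t
  have hN : HasDerivAt (fun x => (ρ - 1) * Real.sin x * Real.cos x)
      ((ρ - 1) * (Real.cos t ^ 2 - Real.sin t ^ 2)) t :=
    ((hs.const_mul (ρ - 1)).mul hc).congr_deriv (by ring)
  have hDen : HasDerivAt (fun x => Real.cos x ^ 2 + ρ * Real.sin x ^ 2)
      (2 * (ρ - 1) * Real.sin t * Real.cos t) t :=
    ((hc.pow 2).add ((hs.pow 2).const_mul ρ)).congr_deriv (by push_cast; ring)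
  refine ((hasDerivAt_id t).add (hN.div hDen hD.ne').arctan).congr_deriv ?_
  have h2 : 1 + ((ρ - 1) * Real.sin t * Real.cos t /
      (Real.cos t ^ 2 + ρ * Real.sin t ^ 2)) ^ 2 = (Real.cos t ^ 2 + ρ ^ 2 * Real.sin t ^ 2) /
      (Real.cos t ^ 2 + ρ * Real.sin t ^ 2) ^ 2 := by
    rw [← hid]
    field_simp
  simp only [Pi.div_apply]
  rw [h2, one_div_div, mul_comm (_ ^ 2 / _), div_mul_div_cancel₀ (pow_ne_zero 2 hD.ne'),
    eq_div_iff hD2.ne', add_mul, div_mul_cancel₀ _ hD2.ne']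
  linear_combination ((ρ - 1) * (Real.cos t ^ 2 - ρ * Real.sin t ^ 2) + ρ) *
    Real.sin_sq_add_cos_sq t

end Rescale

/-- The Prüfer angle of a system with constant coefficients. -/
theorem isPruferAngle_const {B κ α β : ℝ} (hB : 0 < B) (hκ : 0 < κ) :
    IsPruferAngle (fun _ => B) (fun _ => κ ^ 2 / B)
      (fun x => pruferRescale (κ / B) (κ * (x - α))) α β := by
  -- The underlying solution is `u = cos κ(x - α)`, `v = -(κ/B) sin κ(x - α)`, hence the rescaling
  -- factor `κ/B`.
  have hρ : 0 < κ / B := div_pos hκ hB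
  have hcd : ContDiff ℝ 1 fun x => pruferRescale (κ / B) (κ * (x - α)) :=
    (contDiff_pruferRescale hρ).comp (by fun_prop)
  refine ⟨hcd.continuous, HasACDeriv.of_hasDerivAt_contDiff hcd fun x => ?_⟩
  have h1 : HasDerivAt (fun x : ℝ => κ * (x - α)) (κ * 1) x :=
    ((hasDerivAt_id x).sub_const α).const_mul _
  refine ((hasDerivAt_pruferRescale hρ (κ * (x - α))).comp x h1).congr_deriv ?_
  have hD := cos_sq_add_mul_sin_sq_pos (pow_pos hρ 2) (κ * (x - α))
  rw [sin_sq_pruferRescale hρ, cos_sq_pruferRescale hρ]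
  have hsc := Real.sin_sq_add_cos_sq (κ * (x - α))
  generalize Real.sin (κ * (x - α)) = s at *
  generalize Real.cos (κ * (x - α)) = c at *
  rw [← mul_div_assoc, ← mul_div_assoc, ← add_div, mul_one, div_mul_eq_mul_div]
  congr 1
  field_simp
  linear_combination -hsc

/-! ### The angle at `β` as a function of the spectral parameter. -/

/-- The data of a Sturm-Liouville problem in the form `u' = b v`, `v' = (Q - λ) u` with measurable
coefficients between positive, resp. real, constants. -/
structure SLCoeff (b Q : ℝ → ℝ) (b₀ b₁ v₀ v₁ : ℝ) : Prop where
  measurable_b : Measurable b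
  measurable_Q : Measurable Q
  pos : 0 < b₀
  b_mem : ∀ x, b x ∈ Icc b₀ b₁
  Q_mem : ∀ x, Q x ∈ Icc v₀ v₁

namespace SLCoeff

variable {b Q : ℝ → ℝ} {b₀ b₁ v₀ v₁ α β : ℝ}

theorem abs_b_le (h : SLCoeff b Q b₀ b₁ v₀ v₁) (x : ℝ) : |b x| ≤ b₁ := by
  rw [abs_of_nonneg (h.pos.le.trans (h.b_mem x).1)]
  exact (h.b_mem x).2

theorem abs_Q_le (h : SLCoeff b Q b₀ b₁ v₀ v₁) (x : ℝ) : |Q x| ≤ max |v₀| |v₁| :=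
  abs_le_max_abs_abs (h.Q_mem x).1 (h.Q_mem x).2

theorem abs_q_le (h : SLCoeff b Q b₀ b₁ v₀ v₁) (l x : ℝ) : |l - Q x| ≤ |l| + max |v₀| |v₁| :=
  (abs_sub _ _).trans (by gcongr; exact h.abs_Q_le x)

theorem abs_sub_le (h : SLCoeff b Q b₀ b₁ v₀ v₁) (l x : ℝ) :
    |b x - (l - Q x)| ≤ b₁ + (|l| + max |v₀| |v₁|) :=
  (abs_sub _ _).trans (add_le_add (h.abs_b_le x) (h.abs_q_le l x))

theorem measurable_q (h : SLCoeff b Q b₀ b₁ v₀ v₁) (l : ℝ) :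
    Measurable fun x => l - Q x :=
  measurable_const.sub h.measurable_Q

theorem exists_angle (h : SLCoeff b Q b₀ b₁ v₀ v₁) (hαβ : α ≤ β) :
    ∃ θ : ℝ → ℝ → ℝ, ∀ l, IsPruferAngle b (fun x => l - Q x) (θ l) α β ∧ θ l α = 0 :=
  ⟨_, fun l => (exists_isPruferAngle hαβ h.measurable_b (h.measurable_q l) h.abs_b_le
    (h.abs_q_le l)).choose_spec⟩

variable {θ : ℝ → ℝ → ℝ}

/-- Comparison gives weak monotonicity. If two angles agreed at `β` they would agree on all of `[α,
β]`; equating their derivatives gives `cos θ = 0` almost everywhere, hence everywhere by continuity,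
against `θ(α) = 0`. -/
theorem strictMono_angle (h : SLCoeff b Q b₀ b₁ v₀ v₁)
    (hθ : ∀ l, IsPruferAngle b (fun x => l - Q x) (θ l) α β ∧ θ l α = 0) (hαβ : α < β) :
    StrictMono fun l => θ l β := by
  intro l m hlm
  have hc := (hθ l).1.le_of_coeff_le hαβ.le (hθ m).1 h.measurable_b (h.measurable_q l)
    (h.abs_sub_le l) (fun _ => le_rfl) (fun x => sub_le_sub_right hlm.le _)
    ((hθ l).2.trans (hθ m).2.symm).le
  refine lt_of_le_of_ne (hc.1 β (right_mem_Icc.2 hαβ.le)) fun he => ?_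
  have heq := hc.2 he
  have hne : ∀ᵐ x, x ∈ Ioo α β → Real.cos (θ m x) = 0 := by
    filter_upwards [(hθ l).1.hasACDeriv.ae, (hθ m).1.hasACDeriv.ae] with x h1 h2 hx
    rw [uIcc_of_le hαβ.le] at h1 h2
    have hx' := Ioo_subset_Icc_self hx
    have h3 := (h2 hx').congr_of_eventuallyEq (f₁ := θ l) (by
      filter_upwards [Ioo_mem_nhds hx.1 hx.2] with y hy using (heq y (Ioo_subset_Icc_self hy)).symm)
    have h4 := (h1 hx').unique h3
    rw [heq x hx'] at h4 ⊢
    have h5 : (m - l) * Real.cos (θ l x) ^ 2 = 0 := by linear_combination -h4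
    simpa [sub_ne_zero.2 hlm.ne'] using h5
  have h0 : ∀ᵐ x ∂volume.restrict (Icc α β), Real.cos (θ m x) = 0 := by
    rwa [← restrict_Ioo_eq_restrict_Icc, ae_restrict_iff' measurableSet_Ioo]
  have h1 := Measure.eqOn_Icc_of_ae_eq volume hαβ.ne h0
    (Real.continuous_cos.comp (hθ m).1.continuous).continuousOn
    (continuousOn_const (c := (0 : ℝ))) (left_mem_Icc.2 hαβ.le)
  simp [(hθ m).2] at h1

/-- The difference of the angles for `m` and `l` has forcing `(m - l) cos²`, and the bound `K` on
its linear coefficient depends on `l` only, so the growth bound is linear in `|m - l|`. -/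
theorem continuous_angle (h : SLCoeff b Q b₀ b₁ v₀ v₁)
    (hθ : ∀ l, IsPruferAngle b (fun x => l - Q x) (θ l) α β ∧ θ l α = 0) (hαβ : α ≤ β) :
    Continuous fun l => θ l β := by
  rw [continuous_iff_continuousAt]
  intro l
  set K := b₁ + (|l| + max |v₀| |v₁|)
  have hbd : ∀ m, dist (θ m β) (θ l β) ≤ Real.exp (2 * K * (β - α)) * |m - l| * (β - α) := by
    intro m
    have hd := (hθ l).1.hasACDeriv_sub (hθ m).1
    refine hd.abs_le_of_linear hαβ
      (IsPruferAngle.measurable_diffCoeff h.measurable_b (h.measurable_q l)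
        (hθ l).1.continuous (hθ m).1.continuous)
      (IsPruferAngle.abs_diffCoeff_le (h.abs_sub_le l)) (fun x => ?_)
      (by simp [(hθ l).2, (hθ m).2])
    have : (b x - b x) * Real.sin (θ m x) ^ 2 + (m - Q x - (l - Q x)) * Real.cos (θ m x) ^ 2 =
        (m - l) * Real.cos (θ m x) ^ 2 := by ring
    rw [this, abs_mul, abs_of_nonneg (sq_nonneg (Real.cos _))]
    exact mul_le_of_le_one_right (abs_nonneg _) (Real.cos_sq_le_one _)
  refine tendsto_iff_dist_tendsto_zero.2 (squeeze_zero (fun _ => dist_nonneg) hbd ?_)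
  have hc : Continuous fun m : ℝ => Real.exp (2 * K * (β - α)) * |m - l| * (β - α) := by fun_prop
  simpa using hc.tendsto l

/-- The constant `-π/2` is an angle for the same `q` and `b = 0`, because the cosine vanishes there;
it is a barrier that no angle starting at `0` can cross downwards. -/
theorem neg_pi_div_two_le_angle (h : SLCoeff b Q b₀ b₁ v₀ v₁)
    (hθ : ∀ l, IsPruferAngle b (fun x => l - Q x) (θ l) α β ∧ θ l α = 0) (hαβ : α ≤ β) (l : ℝ) :
    -(Real.pi / 2) ≤ θ l β := by
  have hψ : IsPruferAngle (fun _ => 0) (fun x => l - Q x) (fun _ => -(Real.pi / 2)) α β :=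
    ⟨continuous_const, (HasACDeriv.const _).congr_deriv fun x _ => by simp⟩
  refine (hψ.le_of_coeff_le hαβ (hθ l).1 measurable_const (h.measurable_q l)
    (K := |l| + max |v₀| |v₁|) (fun x => ?_) (fun x => h.pos.le.trans (h.b_mem x).1)
    (fun _ => le_rfl) ?_).1 β (right_mem_Icc.2 hαβ)
  · simpa only [zero_sub, abs_neg] using h.abs_q_le l x
  · rw [(hθ l).2]
    linarith [Real.pi_pos]

/-- An upper bound for the coefficients bounds the angle from above. -/
theorem angle_le_nat_mul_pi (h : SLCoeff b Q b₀ b₁ v₀ v₁)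
    (hθ : ∀ l, IsPruferAngle b (fun x => l - Q x) (θ l) α β ∧ θ l α = 0) (hαβ : α < β) (i : ℕ) :
    θ ((i * Real.pi / (β - α)) ^ 2 / b₁ + v₀) β ≤ i * Real.pi := by
  set l := (i * Real.pi / (β - α)) ^ 2 / b₁ + v₀ with hl
  have hq : ∀ x, l - Q x ≤ (i * Real.pi / (β - α)) ^ 2 / b₁ := fun x => by
    linarith [(h.Q_mem x).1]
  -- For `i = 0` the comparison frequency is zero and the rescaling degenerates; the zero angle,
  -- with `q = 0` and the same `b`, takes its place.
  rcases Nat.eq_zero_or_pos i with rfl | hi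
  · have hψ : IsPruferAngle b (fun _ => 0) (fun _ => 0) α β :=
      ⟨continuous_const, (HasACDeriv.const _).congr_deriv fun x _ => by simp⟩
    simpa using ((hθ l).1.le_of_coeff_le hαβ.le hψ h.measurable_b (h.measurable_q l)
      (h.abs_sub_le l) (fun _ => le_rfl) (fun x => by simpa using hq x) (hθ l).2.le).1 β
      (right_mem_Icc.2 hαβ.le)
  · have hκ : 0 < i * Real.pi / (β - α) :=
      div_pos (mul_pos (Nat.cast_pos.2 hi) Real.pi_pos) (sub_pos.2 hαβ)
    have hb₁ : 0 < b₁ := h.pos.trans_le ((h.b_mem 0).1.trans (h.b_mem 0).2)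
    have h1 := ((hθ l).1.le_of_coeff_le hαβ.le (isPruferAngle_const hb₁ hκ) h.measurable_b
      (h.measurable_q l) (h.abs_sub_le l) (fun x => (h.b_mem x).2) hq
      (by simp [(hθ l).2, pruferRescale])).1 β (right_mem_Icc.2 hαβ.le)
    rwa [div_mul_cancel₀ _ (sub_pos.2 hαβ).ne', pruferRescale_nat_mul_pi] at h1

/-- A lower bound for the coefficients bounds the angle from below. -/
theorem nat_mul_pi_le_angle (h : SLCoeff b Q b₀ b₁ v₀ v₁)
    (hθ : ∀ l, IsPruferAngle b (fun x => l - Q x) (θ l) α β ∧ θ l α = 0) (hαβ : α < β) (i : ℕ) :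
    i * Real.pi ≤ θ ((i * Real.pi / (β - α)) ^ 2 / b₀ + v₁) β := by
  set l := (i * Real.pi / (β - α)) ^ 2 / b₀ + v₁ with hl
  have hq : ∀ x, (i * Real.pi / (β - α)) ^ 2 / b₀ ≤ l - Q x := fun x => by
    linarith [(h.Q_mem x).2]
  rcases Nat.eq_zero_or_pos i with rfl | hi
  · have hψ : IsPruferAngle b (fun _ => 0) (fun _ => 0) α β :=
      ⟨continuous_const, (HasACDeriv.const _).congr_deriv fun x _ => by simp⟩
    simpa using (hψ.le_of_coeff_le hαβ.le (hθ l).1 h.measurable_b measurable_const (K := b₁)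
      (fun x => by simpa using h.abs_b_le x) (fun _ => le_rfl) (fun x => by simpa using hq x)
      (hθ l).2.ge).1 β (right_mem_Icc.2 hαβ.le)
  · have hκ : 0 < i * Real.pi / (β - α) :=
      div_pos (mul_pos (Nat.cast_pos.2 hi) Real.pi_pos) (sub_pos.2 hαβ)
    have h1 := ((isPruferAngle_const h.pos hκ).le_of_coeff_le hαβ.le (hθ l).1 measurable_const
      measurable_const (fun _ => le_rfl) (fun x => (h.b_mem x).1) hq
      (by simp [(hθ l).2, pruferRescale])).1 β (right_mem_Icc.2 hαβ.le)
    rwa [div_mul_cancel₀ _ (sub_pos.2 hαβ).ne', pruferRescale_nat_mul_pi] at h1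

/-- The parameters for which the Prüfer angle at `β` is a multiple of `π`. -/
theorem exists_eigenvalues (h : SLCoeff b Q b₀ b₁ v₀ v₁)
    (hθ : ∀ l, IsPruferAngle b (fun x => l - Q x) (θ l) α β ∧ θ l α = 0) (hαβ : α < β) :
    ∃ ev : ℕ → ℝ, StrictMono ev ∧ (∀ l, Real.sin (θ l β) = 0 ↔ ∃ i, ev i = l) ∧
      ∀ i : ℕ, (i * Real.pi / (β - α)) ^ 2 / b₁ + v₀ ≤ ev i ∧
        ev i ≤ (i * Real.pi / (β - α)) ^ 2 / b₀ + v₁ := by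
  have hmono := h.strictMono_angle hθ hαβ
  have hex : ∀ i : ℕ, ∃ l, θ l β = i * Real.pi := fun i =>
    mem_range_of_exists_le_of_exists_ge (h.continuous_angle hθ hαβ.le)
      ⟨_, h.angle_le_nat_mul_pi hθ hαβ i⟩ ⟨_, h.nat_mul_pi_le_angle hθ hαβ i⟩
  choose ev hev using hex
  refine ⟨ev, fun i j hij => ?_, fun l => ⟨fun hl => ?_, ?_⟩, fun i => ⟨?_, ?_⟩⟩
  · rw [← hmono.lt_iff_lt]
    simp only [hev]
    have : (i : ℝ) < j := Nat.cast_lt.2 hij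
    exact mul_lt_mul_of_pos_right this Real.pi_pos
  · obtain ⟨n, hn⟩ := Real.sin_eq_zero_iff.1 hl
    have hlow := h.neg_pi_div_two_le_angle hθ hαβ.le l
    -- A negative `n` would put the angle at or below `-π`, under the barrier `-π/2`.
    have hn0 : 0 ≤ n := by
      by_contra! hneg
      have : (n : ℝ) ≤ -1 := by exact_mod_cast Int.le_sub_one_of_lt hneg
      nlinarith [Real.pi_pos]
    lift n to ℕ using hn0
    refine ⟨n, hmono.injective ?_⟩
    simpa only [hev, Int.cast_natCast] using hn
  · rintro ⟨i, rfl⟩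
    rw [hev, Real.sin_nat_mul_pi]
  · rw [← hmono.le_iff_le]
    simpa only [hev] using h.angle_le_nat_mul_pi hθ hαβ i
  · rw [← hmono.le_iff_le]
    simpa only [hev] using h.nat_mul_pi_le_angle hθ hαβ i

end SLCoeff

/-! ### Eigenspaces through the graph, and reality of the spectral parameter. -/

theorem ae_restrict_Ioo_iff_uIcc {α β : ℝ} (h : α ≤ β) {P : ℝ → Prop} :
    (∀ᵐ x ∂volume.restrict (Ioo α β), P x) ↔ ∀ᵐ x, x ∈ uIcc α β → P x := by
  rw [restrict_Ioo_eq_restrict_Icc, ae_restrict_iff' measurableSet_Icc, uIcc_of_le h]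

theorem LinearPMap.mem_eigenspaceAt_iff {E : Type*} [AddCommGroup E] [Module ℂ E]
    (T : E →ₗ.[ℂ] E) (μ : ℂ) (f : E) : f ∈ T.eigenspaceAt μ ↔ (f, μ • f) ∈ T.graph := by
  simp only [LinearPMap.eigenspaceAt, Submodule.mem_map, LinearMap.mem_ker, LinearMap.sub_apply,
    sub_eq_zero, LinearPMap.mem_graph_iff]
  constructor
  · rintro ⟨y, h1, rfl⟩
    exact ⟨y, rfl, h1⟩
  · rintro ⟨y, h1, h2⟩
    refine ⟨y, ?_, h1⟩
    rw [← h1] at h2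
    exact h2

section Energy

variable {b Q : ℝ → ℝ} {α β : ℝ} {μ : ℂ} {u v : ℝ → ℂ}

/-- The imaginary part of the Green form of a solution. -/
theorem hasACDeriv_im_green (hu : HasACDeriv u (fun x => b x • v x) α β)
    (hv : HasACDeriv v (fun x => ((Q x : ℂ) - μ) * u x) α β) :
    HasACDeriv (fun x => (v x).im * (u x).re - (v x).re * (u x).im)
      (fun x => -μ.im * ‖u x‖ ^ 2) α β := by
  have hur := hu.clm_comp Complex.reCLM
  have hui := hu.clm_comp Complex.imCLM
  have hvr := hv.clm_comp Complex.reCLM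
  have hvi := hv.clm_comp Complex.imCLM
  refine ((hvi.mul hur).sub (hvr.mul hui)).congr_deriv fun x _ => ?_
  rw [Complex.sq_norm, Complex.normSq_apply]
  simp
  ring

/-- A nontrivial solution of the Neumann problem has a real spectral parameter. -/
theorem eqOn_zero_of_im_ne_zero (hαβ : α < β) (hu : HasACDeriv u (fun x => b x • v x) α β)
    (hv : HasACDeriv v (fun x => ((Q x : ℂ) - μ) * u x) α β) (hα : v α = 0) (hβ : v β = 0)
    (hμ : μ.im ≠ 0) : ∀ x ∈ Icc α β, u x = 0 := by
  -- The Green form vanishes at both ends, so `μ.im` times the integral of `‖u‖²` is zero.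
  have h := (hasACDeriv_im_green hu hv).integral_eq_sub
  have hcont : ContinuousOn (fun x => ‖u x‖ ^ 2) (uIcc α β) := hu.ac.continuousOn.norm.pow 2
  rw [hα, hβ, intervalIntegral.integral_const_mul] at h
  have h0 : ∫ x in α..β, ‖u x‖ ^ 2 = 0 := by simpa [hμ] using h
  rw [intervalIntegral.integral_eq_zero_iff_of_le_of_nonneg_ae hαβ.le
    (Filter.Eventually.of_forall fun x => sq_nonneg _) hcont.intervalIntegrable,
    restrict_Ioc_eq_restrict_Icc] at h0
  have h1 := Measure.eqOn_Icc_of_ae_eq volume hαβ.ne h0 (by rwa [uIcc_of_le hαβ.le] at hcont)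
    continuousOn_const
  intro x hx
  simpa using h1 hx

end Energy

/-! ### The Prüfer radius and the real solution. -/

/-- The coefficient of the linear equation of the Prüfer radius. -/
noncomputable def pruferRadiusCoeff (b q θ : ℝ → ℝ) (x : ℝ) : ℝ :=
  (b x - q x) * (Real.sin (θ x) * Real.cos (θ x))

/-- The Prüfer radius, normalised to be `1` at `α`. -/
noncomputable def pruferRadius (b q θ : ℝ → ℝ) (α x : ℝ) : ℝ :=
  Real.exp (-∫ t in α..x, pruferRadiusCoeff b q θ t)

namespace SLCoeff

variable {b Q θ : ℝ → ℝ} {b₀ b₁ v₀ v₁ α β l : ℝ}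

theorem measurable_radiusCoeff (h : SLCoeff b Q b₀ b₁ v₀ v₁)
    (hθ : IsPruferAngle b (fun x => l - Q x) θ α β) :
    Measurable (pruferRadiusCoeff b (fun x => l - Q x) θ) :=
  (h.measurable_b.sub (h.measurable_q l)).mul
    ((Real.continuous_sin.comp hθ.continuous).mul
      (Real.continuous_cos.comp hθ.continuous)).measurable

theorem abs_radiusCoeff_le (h : SLCoeff b Q b₀ b₁ v₀ v₁) (x : ℝ) :
    |pruferRadiusCoeff b (fun x => l - Q x) θ x| ≤ b₁ + (|l| + max |v₀| |v₁|) := by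
  rw [pruferRadiusCoeff, abs_mul, abs_mul]
  exact (mul_le_of_le_one_right (abs_nonneg _) (mul_le_one₀ (Real.abs_sin_le_one _)
    (abs_nonneg _) (Real.abs_cos_le_one _))).trans (h.abs_sub_le l x)

theorem hasACDeriv_radius (h : SLCoeff b Q b₀ b₁ v₀ v₁)
    (hθ : IsPruferAngle b (fun x => l - Q x) θ α β) :
    HasACDeriv (pruferRadius b (fun x => l - Q x) θ α)
      (fun x => -pruferRadiusCoeff b (fun x => l - Q x) θ x *
        pruferRadius b (fun x => l - Q x) θ α x) α β :=
  (hasACDeriv_primitive (h.measurable_radiusCoeff hθ) h.abs_radiusCoeff_le α β).neg.exp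

theorem continuous_radius (h : SLCoeff b Q b₀ b₁ v₀ v₁)
    (hθ : IsPruferAngle b (fun x => l - Q x) θ α β) :
    Continuous (pruferRadius b (fun x => l - Q x) θ α) :=
  Real.continuous_exp.comp (intervalIntegral.continuous_primitive
    (fun c d => intervalIntegrable_of_measurable_of_bound (h.measurable_radiusCoeff hθ)
      h.abs_radiusCoeff_le c d) α).neg

/-- First component of the real solution with Prüfer angle `θ`. -/
theorem hasACDeriv_radius_mul_cos (h : SLCoeff b Q b₀ b₁ v₀ v₁)
    (hθ : IsPruferAngle b (fun x => l - Q x) θ α β) :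
    HasACDeriv (fun x => pruferRadius b (fun x => l - Q x) θ α x * Real.cos (θ x))
      (fun x => b x * -(pruferRadius b (fun x => l - Q x) θ α x * Real.sin (θ x))) α β := by
  refine ((h.hasACDeriv_radius hθ).mul hθ.hasACDeriv.cos).congr_deriv fun x _ => ?_
  rw [pruferRadiusCoeff]
  linear_combination (-(pruferRadius b (fun x => l - Q x) θ α x * Real.sin (θ x) * b x)) *
    Real.sin_sq_add_cos_sq (θ x)

/-- Second component of the real solution with Prüfer angle `θ`. -/
theorem hasACDeriv_radius_mul_sin (h : SLCoeff b Q b₀ b₁ v₀ v₁)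
    (hθ : IsPruferAngle b (fun x => l - Q x) θ α β) :
    HasACDeriv (fun x => -(pruferRadius b (fun x => l - Q x) θ α x * Real.sin (θ x)))
      (fun x => (Q x - l) * (pruferRadius b (fun x => l - Q x) θ α x * Real.cos (θ x))) α β := by
  refine ((h.hasACDeriv_radius hθ).mul hθ.hasACDeriv.sin).neg.congr_deriv fun x _ => ?_
  rw [pruferRadiusCoeff]
  linear_combination (-(pruferRadius b (fun x => l - Q x) θ α x * Real.cos (θ x) * (l - Q x))) *
    Real.sin_sq_add_cos_sq (θ x)

/-- Every complex solution with `v α = 0` is a multiple of the real solution. -/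
theorem eq_radius_smul (h : SLCoeff b Q b₀ b₁ v₀ v₁)
    (hθ : IsPruferAngle b (fun x => l - Q x) θ α β) (hθα : θ α = 0) {u v : ℝ → ℂ}
    (hu : HasACDeriv u (fun x => b x • v x) α β)
    (hv : HasACDeriv v (fun x => ((Q x : ℂ) - l) * u x) α β) (hα : v α = 0)
    {x : ℝ} (hx : x ∈ uIcc α β) :
    u x = (pruferRadius b (fun x => l - Q x) θ α x * Real.cos (θ x)) • u α ∧
      v x = -(pruferRadius b (fun x => l - Q x) θ α x * Real.sin (θ x)) • u α := by
  set k := pruferRadiusCoeff b (fun x => l - Q x) θ with hk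
  have hkm : Measurable k := h.measurable_radiusCoeff hθ
  have hkb : ∀ x, |k x| ≤ b₁ + (|l| + max |v₀| |v₁|) := h.abs_radiusCoeff_le
  have hsin := hθ.hasACDeriv.sin
  have hcos := hθ.hasACDeriv.cos
  have hsc : ∀ x, (Real.sin (θ x) : ℂ) ^ 2 + (Real.cos (θ x) : ℂ) ^ 2 = 1 := fun x => by
    exact_mod_cast Real.sin_sq_add_cos_sq (θ x)
  -- Rotate `(u, v)` by the angle. The component transverse to the Prüfer direction solves a
  -- homogeneous linear equation and vanishes at `α`, hence identically.
  have hd : HasACDeriv (fun x => Real.sin (θ x) • u x + Real.cos (θ x) • v x)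
      (fun x => k x • (Real.sin (θ x) • u x + Real.cos (θ x) • v x)) α β := by
    refine ((hsin.smul hu).add (hcos.smul hv)).congr_deriv fun x _ => ?_
    rw [hk, pruferRadiusCoeff]
    simp only [Complex.real_smul, Complex.ofReal_mul, Complex.ofReal_add, Complex.ofReal_sub,
      Complex.ofReal_neg, Complex.ofReal_pow]
    linear_combination (((l : ℂ) - Q x) * Real.cos (θ x) * u x - Real.sin (θ x) * b x * v x) *
      hsc x
  have hd0 : ∀ x ∈ uIcc α β, Real.sin (θ x) • u x + Real.cos (θ x) • v x = 0 := fun x hx => by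
    have := hd.eq_exp_smul hkm hkb hx
    simpa [hθα, hα] using this
  -- Once the transverse component is zero, the component along the Prüfer direction obeys the
  -- equation of the radius; rotating back at the end recovers `u` and `v`.
  have hC : HasACDeriv (fun x => Real.cos (θ x) • u x - Real.sin (θ x) • v x)
      (fun x => -k x • (Real.cos (θ x) • u x - Real.sin (θ x) • v x)) α β := by
    refine ((hcos.smul hu).sub (hsin.smul hv)).congr_deriv fun x hx => ?_
    have h1 := hd0 x hx
    rw [hk, pruferRadiusCoeff]
    simp only [Complex.real_smul, Complex.ofReal_mul, Complex.ofReal_add, Complex.ofReal_sub,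
      Complex.ofReal_neg, Complex.ofReal_pow] at h1 ⊢
    linear_combination (((l : ℂ) - Q x - b x) * (Real.sin (θ x) ^ 2 - Real.cos (θ x) ^ 2)) * h1 -
      (b x * Real.cos (θ x) * v x + ((l : ℂ) - Q x) * Real.sin (θ x) * u x) * hsc x
  have hCx := hC.eq_exp_smul (k := fun x => -k x) hkm.neg (fun x => by simpa using hkb x) hx
  rw [intervalIntegral.integral_neg] at hCx
  simp only [hθα, hα, Real.cos_zero, one_smul, smul_zero, sub_zero] at hCx
  change _ = pruferRadius b (fun x => l - Q x) θ α x • u α at hCx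
  have h1 := hd0 x hx
  have h2 := hsc x
  simp only [Complex.real_smul] at h1 hCx ⊢
  constructor
  · simp only [Complex.ofReal_mul]
    linear_combination (-u x) * h2 + (Real.sin (θ x) : ℂ) * h1 + (Real.cos (θ x) : ℂ) * hCx
  · simp only [Complex.ofReal_mul, Complex.ofReal_neg]
    linear_combination (-v x) * h2 + (Real.cos (θ x) : ℂ) * h1 - (Real.sin (θ x) : ℂ) * hCx

end SLCoeff

/-! ### Eigenfunctions as solutions of the first order system. -/

section Graph

variable {a V b Q : ℝ → ℝ} {b₀ b₁ v₀ v₁ α β : ℝ}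

/-- An eigenfunction gives a solution of the first order system. -/
theorem exists_solution_of_mem_neumannGraph (hαβ : α < β) (h : SLCoeff b Q b₀ b₁ v₀ v₁)
    (hbc : Continuous b) (hab : ∀ x ∈ Icc α β, a x * b x = 1)
    (hVQ : ∀ᵐ x ∂volume.restrict (Ioo α β), V x = Q x) {μ : ℂ} {f : L2Interval α β}
    (hf : (f, μ • f) ∈ neumannGraph α β a V) :
    ∃ u v : ℝ → ℂ, f =ᵐ[volume.restrict (Ioo α β)] u ∧
      HasACDeriv u (fun x => b x • v x) α β ∧
      HasACDeriv v (fun x => ((Q x : ℂ) - μ) * u x) α β ∧ v α = 0 ∧ v β = 0 := by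
  obtain ⟨u, hfu, hd, -, hβ, hi, hint⟩ := hf
  simp only at hfu hint
  set F : ℝ → ℂ := fun t => (V t : ℂ) * u t - (μ • f : L2Interval α β) t with hF
  have hgi : IntegrableOn (μ • f : L2Interval α β) (Ioo α β) :=
    (Lp.memLp (μ • f)).integrable (by norm_num)
  have hFi : IntervalIntegrable F volume α β := by
    rw [intervalIntegrable_iff_integrableOn_Ioo_of_le hαβ.le]
    exact hi.sub hgi
  -- Since `u` is continuous on a compact interval, `(Q - μ) u` is bounded there; this makes the
  -- primitive `v` Lipschitz.
  have hFeq : ∀ᵐ x, x ∈ uIcc α β → F x = ((Q x : ℂ) - μ) * u x := by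
    rw [← ae_restrict_Ioo_iff_uIcc hαβ.le]
    filter_upwards [hfu, hVQ, Lp.coeFn_smul μ f] with x h1 h2 h3
    rw [hF]
    simp only [h2, h3, Pi.smul_apply, h1, smul_eq_mul]
    ring
  obtain ⟨C, hC⟩ := isCompact_Icc.exists_bound_of_continuousOn hd.continuousOn
  have hC0 : 0 ≤ C := (norm_nonneg _).trans (hC α (left_mem_Icc.2 hαβ.le))
  set M := (max |v₀| |v₁| + ‖μ‖) * C with hM
  have hM0 : 0 ≤ M := by positivity
  have hFb : ∀ᵐ x, x ∈ uIcc α β → ‖F x‖ ≤ M := by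
    filter_upwards [hFeq] with x h1 hx
    rw [h1 hx, norm_mul]
    rw [uIcc_of_le hαβ.le] at hx
    refine mul_le_mul ((norm_sub_le _ _).trans (add_le_add ?_ le_rfl)) (hC x hx) (norm_nonneg _)
      (by positivity)
    simpa using h.abs_Q_le x
  have hv := hasACDeriv_intervalIntegral hM0 hFi hFb
  set v : ℝ → ℂ := fun x => ∫ t in α..x, F t with hvdef
  have hder : ∀ x ∈ Icc α β, derivWithin u (Icc α β) x = b x • v x := fun x hx => by
    have h1 := hint x hx
    have h2 : (a x : ℂ) * b x = 1 := by exact_mod_cast hab x hx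
    change _ = v x at h1
    rw [← h1, Complex.real_smul]
    linear_combination (-derivWithin u (Icc α β) x) * h2
  have hvc : ContinuousOn v (Icc α β) := by
    have := hv.ac.continuousOn
    rwa [uIcc_of_le hαβ.le] at this
  obtain ⟨D, hD⟩ := isCompact_Icc.exists_bound_of_continuousOn (hbc.continuousOn.smul hvc)
  -- So far `u` is only differentiable; but `u' = b v` is continuous, hence bounded, which gives
  -- absolute continuity.
  have hlip : LipschitzOnWith D.toNNReal u (uIcc α β) := by
    rw [uIcc_of_le hαβ.le]
    refine (convex_Icc α β).lipschitzOnWith_of_nnnorm_derivWithin_le hd fun x hx => ?_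
    rw [← NNReal.coe_le_coe, coe_nnnorm, hder x hx]
    exact (hD x hx).trans (Real.le_coe_toNNReal D)
  refine ⟨u, v, hfu, ⟨hlip.absolutelyContinuousOnInterval, ?_⟩, hv.congr_ae hFeq,
    intervalIntegral.integral_same, ?_⟩
  · rw [← ae_restrict_Ioo_iff_uIcc hαβ.le, ae_restrict_iff' measurableSet_Ioo]
    refine Filter.Eventually.of_forall fun x hx => ?_
    rw [← hder x (Ioo_subset_Icc_self hx)]
    exact (hd x (Ioo_subset_Icc_self hx)).hasDerivWithinAt.hasDerivAt (Icc_mem_nhds hx.1 hx.2)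
  · have := hint β (right_mem_Icc.2 hαβ.le)
    rw [hβ, mul_zero] at this
    exact this.symm

theorem eq_zero_of_eqOn_zero {f : L2Interval α β} {u : ℝ → ℂ}
    (hf : f =ᵐ[volume.restrict (Ioo α β)] u) (hu : ∀ x ∈ Icc α β, u x = 0) : f = 0 := by
  refine (Lp.eq_zero_iff_ae_eq_zero).2 ?_
  filter_upwards [hf, ae_restrict_mem measurableSet_Ioo] with x h1 h2
  rw [h1, hu x (Ioo_subset_Icc_self h2)]
  rfl

/-- The parameter of an eigenfunction is real. -/
theorem im_eq_zero_of_mem_neumannGraph (hαβ : α < β) (h : SLCoeff b Q b₀ b₁ v₀ v₁)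
    (hbc : Continuous b) (hab : ∀ x ∈ Icc α β, a x * b x = 1)
    (hVQ : ∀ᵐ x ∂volume.restrict (Ioo α β), V x = Q x) {μ : ℂ} {f : L2Interval α β}
    (hf : (f, μ • f) ∈ neumannGraph α β a V) (hf0 : f ≠ 0) : μ.im = 0 := by
  obtain ⟨u, v, hfu, hu, hv, h1, h2⟩ :=
    exists_solution_of_mem_neumannGraph hαβ h hbc hab hVQ hf
  by_contra hμ
  exact hf0 (eq_zero_of_eqOn_zero hfu (eqOn_zero_of_im_ne_zero hαβ hu hv h1 h2 hμ))

variable {θ : ℝ → ℝ} {l : ℝ}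

/-- The real solution with Prüfer angle `θ`. -/
noncomputable def pruferSolution (b Q θ : ℝ → ℝ) (α l x : ℝ) : ℂ :=
  ((pruferRadius b (fun x => l - Q x) θ α x * Real.cos (θ x) : ℝ) : ℂ)

theorem continuous_pruferSolution (h : SLCoeff b Q b₀ b₁ v₀ v₁)
    (hθ : IsPruferAngle b (fun x => l - Q x) θ α β) : Continuous (pruferSolution b Q θ α l) :=
  Complex.continuous_ofReal.comp
    ((h.continuous_radius hθ).mul (Real.continuous_cos.comp hθ.continuous))

theorem memLp_pruferSolution (h : SLCoeff b Q b₀ b₁ v₀ v₁)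
    (hθ : IsPruferAngle b (fun x => l - Q x) θ α β) :
    MemLp (pruferSolution b Q θ α l) 2 (volume.restrict (Ioo α β)) := by
  have hc := continuous_pruferSolution h hθ
  obtain ⟨C, hC⟩ := (isCompact_Icc (a := α) (b := β)).exists_bound_of_continuousOn hc.continuousOn
  exact MemLp.of_bound hc.aestronglyMeasurable C ((ae_restrict_iff' measurableSet_Ioo).2
    (Filter.Eventually.of_forall fun x hx => hC x (Ioo_subset_Icc_self hx)))

/-- Eigenfunctions are multiples of the real solution, and they exist only if the Prüfer angle at
`β` is a multiple of `π`. -/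
theorem eq_smul_of_mem_neumannGraph (hαβ : α < β) (h : SLCoeff b Q b₀ b₁ v₀ v₁)
    (hbc : Continuous b) (hab : ∀ x ∈ Icc α β, a x * b x = 1)
    (hVQ : ∀ᵐ x ∂volume.restrict (Ioo α β), V x = Q x)
    (hθ : IsPruferAngle b (fun x => l - Q x) θ α β) (hθα : θ α = 0) {f : L2Interval α β}
    (hf : (f, (l : ℂ) • f) ∈ neumannGraph α β a V) :
    (∃ c : ℂ, f = c • (memLp_pruferSolution h hθ).toLp) ∧ (f ≠ 0 → Real.sin (θ β) = 0) := by
  obtain ⟨u, v, hfu, hu, hv, h1, h2⟩ :=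
    exists_solution_of_mem_neumannGraph hαβ h hbc hab hVQ hf
  have hsol := fun x hx => h.eq_radius_smul hθ hθα hu hv h1 (x := x) hx
  constructor
  · refine ⟨u α, Lp.ext ?_⟩
    filter_upwards [hfu, ae_restrict_mem measurableSet_Ioo,
      Lp.coeFn_smul (u α) (memLp_pruferSolution h hθ).toLp,
      (memLp_pruferSolution h hθ).coeFn_toLp] with x e1 hx e2 e3
    rw [e1, e2, Pi.smul_apply, e3, (hsol x (by
      rw [uIcc_of_le hαβ.le]
      exact Ioo_subset_Icc_self hx)).1, pruferSolution, smul_eq_mul, Complex.real_smul, mul_comm]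
  · intro hf0
    by_contra hs
    have h3 := (hsol β right_mem_uIcc).2
    rw [h2, eq_comm, smul_eq_zero, neg_eq_zero, mul_eq_zero] at h3
    have hr : pruferRadius b (fun x => l - Q x) θ α β ≠ 0 := (Real.exp_pos _).ne'
    have hu0 : u α = 0 := by tauto
    refine hf0 (eq_zero_of_eqOn_zero hfu fun x hx => ?_)
    rw [(hsol x (by rwa [uIcc_of_le hαβ.le])).1, hu0, smul_zero]

/-- The solution is continuous with value `1` at `α`, so it cannot vanish almost everywhere. -/
theorem toLp_pruferSolution_ne_zero (hαβ : α < β) (h : SLCoeff b Q b₀ b₁ v₀ v₁)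
    (hθ : IsPruferAngle b (fun x => l - Q x) θ α β) (hθα : θ α = 0) :
    (memLp_pruferSolution h hθ).toLp ≠ 0 := by
  intro h0
  have h1 := (Lp.eq_zero_iff_ae_eq_zero).1 h0
  have h2 := (memLp_pruferSolution h hθ).coeFn_toLp.symm.trans h1
  rw [restrict_Ioo_eq_restrict_Icc] at h2
  have h3 := Measure.eqOn_Icc_of_ae_eq volume hαβ.ne h2
    (continuous_pruferSolution h hθ).continuousOn (continuousOn_const (c := (0 : ℂ)))
    (left_mem_Icc.2 hαβ.le)
  simp [pruferSolution, hθα, pruferRadius] at h3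

/-- The real solution is an eigenfunction if the Prüfer angle at `β` is a multiple of `π`. -/
theorem pruferSolution_mem_neumannGraph (hαβ : α < β) (h : SLCoeff b Q b₀ b₁ v₀ v₁)
    (hbc : Continuous b) (hab : ∀ x ∈ Icc α β, a x * b x = 1)
    (hVQ : ∀ᵐ x ∂volume.restrict (Ioo α β), V x = Q x)
    (hθ : IsPruferAngle b (fun x => l - Q x) θ α β) (hθα : θ α = 0)
    (hβ : Real.sin (θ β) = 0) :
    ((memLp_pruferSolution h hθ).toLp, (l : ℂ) • (memLp_pruferSolution h hθ).toLp) ∈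
      neumannGraph α β a V := by
  set φ := (memLp_pruferSolution h hθ).toLp with hφ
  have hφae : φ =ᵐ[volume.restrict (Ioo α β)] pruferSolution b Q θ α l :=
    (memLp_pruferSolution h hθ).coeFn_toLp
  set p : ℝ → ℝ := fun x => -(pruferRadius b (fun x => l - Q x) θ α x * Real.sin (θ x)) with hp
  have hpc : Continuous p :=
    ((h.continuous_radius hθ).mul (Real.continuous_sin.comp hθ.continuous)).neg
  have hu := h.hasACDeriv_radius_mul_cos hθ
  have hpd := h.hasACDeriv_radius_mul_sin hθ
  set y : ℝ → ℝ := fun x => pruferRadius b (fun x => l - Q x) θ α x * Real.cos (θ x) with hy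
  -- The equation `u' = b v` is known only almost everywhere, but `b v` is continuous, so
  -- integrating it back gives the derivative at every point of `[α, β]`.
  have hder : ∀ x ∈ Icc α β, HasDerivWithinAt y (b x * p x) (Icc α β) x := by
    have hc : Continuous fun x => b x * p x := hbc.mul hpc
    have heq : ∀ x ∈ Icc α β, y x = y α + ∫ t in α..x, b t * p t := fun x hx => by
      rw [(hu.mono (uIcc_subset_uIcc left_mem_uIcc (by rwa [uIcc_of_le hαβ.le]))).integral_eq_sub]
      ring
    intro x hx
    exact (((hc.integral_hasStrictDerivAt α x).hasDerivAt.const_add (y α)).hasDerivWithinAt).congr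
      heq (heq x hx)
  have hderC : ∀ x ∈ Icc α β, HasDerivWithinAt (pruferSolution b Q θ α l)
      ((b x * p x : ℝ) : ℂ) (Icc α β) x := fun x hx => (hder x hx).ofReal_comp
  have hdw : ∀ x ∈ Icc α β, derivWithin (pruferSolution b Q θ α l) (Icc α β) x =
      ((b x * p x : ℝ) : ℂ) := fun x hx =>
    (hderC x hx).derivWithin (uniqueDiffOn_Icc hαβ x hx)
  have hpα : p α = 0 := by simp [hp, hθα]
  have hpβ : p β = 0 := by simp [hp, hβ]
  refine ⟨pruferSolution b Q θ α l, hφae, fun x hx => (hderC x hx).differentiableWithinAt, ?_, ?_,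
    ?_, fun x hx => ?_⟩
  · simp [hdw α (left_mem_Icc.2 hαβ.le), hpα]
  · simp [hdw β (right_mem_Icc.2 hαβ.le), hpβ]
  · have hQ : IntegrableOn (fun t => (Q t : ℂ) * pruferSolution b Q θ α l t) (Ioo α β) :=
      ((memLp_pruferSolution h hθ).integrable (by norm_num)).bdd_mul
        (Complex.measurable_ofReal.comp h.measurable_Q).aestronglyMeasurable
        (Filter.Eventually.of_forall fun x => by
          simpa only [Function.comp, Complex.norm_real, Real.norm_eq_abs] using h.abs_Q_le x)
    refine hQ.congr ?_
    filter_upwards [hVQ] with x hx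
    rw [hx]
  · rw [hdw x hx]
    have h1 : (a x : ℂ) * b x = 1 := by exact_mod_cast hab x hx
    have hxu : uIcc α x ⊆ uIcc α β :=
      uIcc_subset_uIcc left_mem_uIcc (by rwa [uIcc_of_le hαβ.le])
    have h2 : p x = ∫ t in α..x, (Q t - l) * y t := by
      rw [(hpd.mono hxu).integral_eq_sub]
      change p x = p x - p α
      rw [hpα, sub_zero]
    calc (a x : ℂ) * ((b x * p x : ℝ) : ℂ) = (p x : ℂ) := by
          push_cast
          linear_combination (p x : ℂ) * h1
      _ = ∫ t in α..x, (((Q t - l) * y t : ℝ) : ℂ) := by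
          rw [h2, intervalIntegral.integral_ofReal]
      _ = _ := by
          refine intervalIntegral.integral_congr_ae ?_
          filter_upwards [(ae_restrict_Ioo_iff_uIcc hαβ.le).1 hVQ,
            (ae_restrict_Ioo_iff_uIcc hαβ.le).1 hφae,
            (ae_restrict_Ioo_iff_uIcc hαβ.le).1 (Lp.coeFn_smul (l : ℂ) φ)] with t e1 e2 e3 ht
          have ht' := hxu (uIoc_subset_uIcc ht)
          simp only [e1 ht', e3 ht', Pi.smul_apply, e2 ht', smul_eq_mul]
          rw [pruferSolution]
          push_cast [hy]
          ring

end Graph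

/-! ### The eigenvalue sequence. -/

/-- A strictly increasing eigenvalue sequence is the only eigenvalue sequence. -/
theorem IsEigenvalueSequence.eq_of_strictMono {E : Type*} [AddCommGroup E] [Module ℂ E]
    {T : E →ₗ.[ℂ] E} {ev ev' : ℕ → ℝ} (h : IsEigenvalueSequence T ev) (hs : StrictMono ev)
    (h' : IsEigenvalueSequence T ev') : ev' = ev := by
  have hcard : ∀ l : ℝ, {i | ev' i = l}.encard = {i | ev i = l}.encard := fun l => by
    simpa using (h'.2 l).trans (h.2 l).symm
  -- Both sequences take each real value equally often. As `ev` takes it at most once, so does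
  -- `ev'`; two strictly increasing sequences with the same range are equal.
  have hinj : Function.Injective ev' := fun i j hij => by
    have h1 : {k | ev' k = ev' j}.encard ≤ 1 := by
      rw [hcard, encard_le_one_iff]
      exact fun k m hk hm => hs.injective (hk.trans hm.symm)
    exact encard_le_one_iff.1 h1 i j hij rfl
  refine ((h'.1.strictMono_of_injective hinj).range_inj hs).1 (Set.ext fun l => ?_)
  have := congrArg (· ≠ 0) (hcard l)
  simpa only [encard_ne_zero, Set.Nonempty, mem_ofPred_eq, eq_iff_iff, mem_range] using this

section Spectrum

variable {a V b Q : ℝ → ℝ} {b₀ b₁ v₀ v₁ α β : ℝ} {θ : ℝ → ℝ → ℝ}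

theorem neumann_mem_eigenspaceAt_iff {μ : ℂ} {f : L2Interval α β} :
    f ∈ (neumannOperator α β a V).eigenspaceAt μ ↔ (f, μ • f) ∈ neumannGraph α β a V := by
  rw [LinearPMap.mem_eigenspaceAt_iff, neumannOperator_graph]

/-- The zeros of the sine of the Prüfer angle at `β` are simple eigenvalues. -/
theorem rank_neumann_eigenspaceAt_eq_one (hαβ : α < β) (h : SLCoeff b Q b₀ b₁ v₀ v₁)
    (hbc : Continuous b) (hab : ∀ x ∈ Icc α β, a x * b x = 1)
    (hVQ : ∀ᵐ x ∂volume.restrict (Ioo α β), V x = Q x) {θ : ℝ → ℝ} {l : ℝ}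
    (hθ : IsPruferAngle b (fun x => l - Q x) θ α β) (hθα : θ α = 0)
    (hl : Real.sin (θ β) = 0) :
    Module.rank ℂ ((neumannOperator α β a V).eigenspaceAt l) = 1 := by
  rw [rank_submodule_eq_one_iff]
  refine ⟨_, neumann_mem_eigenspaceAt_iff.2
    (pruferSolution_mem_neumannGraph hαβ h hbc hab hVQ hθ hθα hl),
    toLp_pruferSolution_ne_zero hαβ h hθ hθα, fun f hf => ?_⟩
  obtain ⟨c, hc⟩ := (eq_smul_of_mem_neumannGraph hαβ h hbc hab hVQ hθ hθα
    (neumann_mem_eigenspaceAt_iff.1 hf)).1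
  exact Submodule.mem_span_singleton.2 ⟨c, hc.symm⟩

/-- A strictly increasing enumeration of the zeros of the sine of the Prüfer angle at `β` is an
eigenvalue sequence. -/
theorem isEigenvalueSequence_neumann (hαβ : α < β) (h : SLCoeff b Q b₀ b₁ v₀ v₁)
    (hbc : Continuous b) (hab : ∀ x ∈ Icc α β, a x * b x = 1)
    (hVQ : ∀ᵐ x ∂volume.restrict (Ioo α β), V x = Q x)
    (hθ : ∀ l, IsPruferAngle b (fun x => l - Q x) (θ l) α β ∧ θ l α = 0) {ev : ℕ → ℝ}
    (hev : StrictMono ev) (hz : ∀ l, Real.sin (θ l β) = 0 ↔ ∃ i, ev i = l) :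
    IsEigenvalueSequence (neumannOperator α β a V) ev := by
  refine ⟨hev.monotone, fun μ => ?_⟩
  by_cases hμ : ∃ i, (ev i : ℂ) = μ
  · obtain ⟨i, rfl⟩ := hμ
    rw [rank_neumann_eigenspaceAt_eq_one hαβ h hbc hab hVQ (hθ (ev i)).1 (hθ (ev i)).2
      ((hz _).2 ⟨i, rfl⟩)]
    have : {j : ℕ | (ev j : ℂ) = ev i} = {i} := by
      ext j
      simp [hev.injective.eq_iff]
    rw [this, encard_singleton, map_one]
  · have h1 : {i : ℕ | (ev i : ℂ) = μ} = ∅ := by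
      ext i
      simpa using fun hi => hμ ⟨i, hi⟩
    have h2 : (neumannOperator α β a V).eigenspaceAt μ = ⊥ := by
      rw [Submodule.eq_bot_iff]
      intro f hf
      by_contra hf0
      rw [neumann_mem_eigenspaceAt_iff] at hf
      have him := im_eq_zero_of_mem_neumannGraph hαβ h hbc hab hVQ hf hf0
      obtain ⟨l, rfl⟩ : ∃ l : ℝ, (l : ℂ) = μ := ⟨μ.re, Complex.ext (by simp) (by simp [him])⟩
      obtain ⟨i, hi⟩ := (hz l).1
        ((eq_smul_of_mem_neumannGraph hαβ h hbc hab hVQ (hθ l).1 (hθ l).2 hf).2 hf0)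
      exact hμ ⟨i, by rw [hi]⟩
    rw [h1, h2]
    simp

end Spectrum

/-- Enclosure of the eigenvalues of the Neumann operator. -/
theorem exists_neumann_eigenvalues (α β : ℝ) (hαβ : α < β) (a V : ℝ → ℝ)
    (ha : ContinuousOn a (Icc α β)) (ha_pos : ∀ x ∈ Icc α β, 0 < a x)
    (hV : AEStronglyMeasurable V (volume.restrict (Ioo α β))) (a₀ a₁ v₀ v₁ : ℝ)
    (ha_bd : ∀ x ∈ Ioo α β, a₀ ≤ a x ∧ a x ≤ a₁)
    (hV_bd : ∀ᵐ x ∂(volume.restrict (Ioo α β)), v₀ ≤ V x ∧ V x ≤ v₁) :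
    ∃ ev : ℕ → ℝ, StrictMono ev ∧ IsEigenvalueSequence (neumannOperator α β a V) ev ∧
      ∀ i : ℕ, a₀ * (i * Real.pi / (β - α)) ^ 2 + v₀ ≤ ev i ∧
        ev i ≤ a₁ * (i * Real.pi / (β - α)) ^ 2 + v₁ := by
  have hcl : closure (Ioo α β) = Icc α β := closure_Ioo hαβ.ne
  have hlo : ∀ x ∈ Icc α β, a₀ ≤ a x := fun x hx =>
    le_on_closure (fun y hy => (ha_bd y hy).1) continuousOn_const (by rwa [hcl]) (by rwa [hcl])
  have hhi : ∀ x ∈ Icc α β, a x ≤ a₁ := fun x hx =>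
    le_on_closure (fun y hy => (ha_bd y hy).2) (by rwa [hcl]) continuousOn_const (by rwa [hcl])
  -- The bound `a₀` may fail to be positive, so `b` is bounded above by the reciprocal of the
  -- minimum of `a`; the stated lower bound then follows from `a₀ ≤ a z`.
  obtain ⟨z, hz, hmin⟩ := isCompact_Icc.exists_isMinOn (nonempty_Icc.2 hαβ.le) ha
  have hzpos := ha_pos z hz
  have ha₁ : 0 < a₁ := hzpos.trans_le (hhi z hz)
  have hv : v₀ ≤ v₁ := by
    have : NeZero (volume.restrict (Ioo α β)) := ⟨by simp [hαβ]⟩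
    obtain ⟨x, hx⟩ := hV_bd.exists
    exact hx.1.trans hx.2
  -- Global versions of the coefficients: `b` extends `1/a` continuously by its endpoint values, and
  -- `Q` is a measurable representative of `V` truncated to `[v₀, v₁]`, so that all bounds hold at
  -- every point.
  set b : ℝ → ℝ := fun x => (a (projIcc α β hαβ.le x))⁻¹ with hb
  set Q : ℝ → ℝ := fun x => max v₀ (min v₁ (hV.mk V x)) with hQ
  have hbc : Continuous b := by
    have h1 : Continuous fun x => a (projIcc α β hαβ.le x) :=
      (continuousOn_iff_continuous_domRestrict.1 ha).comp continuous_projIcc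
    exact h1.inv₀ fun x => (ha_pos _ (projIcc α β hαβ.le x).2).ne'
  have hcoef : SLCoeff b Q a₁⁻¹ (a z)⁻¹ v₀ v₁ := by
    refine ⟨hbc.measurable, ?_, inv_pos.2 ha₁, fun x => ⟨?_, ?_⟩, fun x =>
      ⟨le_max_left _ _, max_le hv (min_le_left _ _)⟩⟩
    · exact measurable_const.max (measurable_const.min hV.stronglyMeasurable_mk.measurable)
    · exact inv_anti₀ (ha_pos _ (projIcc α β hαβ.le x).2) (hhi _ (projIcc α β hαβ.le x).2)
    · exact inv_anti₀ hzpos (hmin (projIcc α β hαβ.le x).2)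
  have hab : ∀ x ∈ Icc α β, a x * b x = 1 := fun x hx => by
    rw [hb]
    simp only [projIcc_of_mem hαβ.le hx]
    exact mul_inv_cancel₀ (ha_pos x hx).ne'
  have hVQ : ∀ᵐ x ∂volume.restrict (Ioo α β), V x = Q x := by
    filter_upwards [hV_bd, hV.ae_eq_mk] with x h1 h2
    rw [hQ]
    simp only [← h2]
    rw [min_eq_right h1.2, max_eq_right h1.1]
  obtain ⟨θ, hθ⟩ := hcoef.exists_angle hαβ.le
  obtain ⟨ev, hev, hzero, hbd⟩ := hcoef.exists_eigenvalues hθ hαβ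
  refine ⟨ev, hev, isEigenvalueSequence_neumann hαβ hcoef hbc hab hVQ hθ hev hzero, fun i =>
    ⟨le_trans ?_ (hbd i).1, (hbd i).2.trans_eq ?_⟩⟩
  · rw [div_inv_eq_mul, mul_comm]
    gcongr
    exact hlo z hz
  · rw [div_inv_eq_mul, mul_comm]

/-! ### Separation of the enclosures and conclusion. -/

/-- Consecutive enclosure intervals below the critical index are ordered. -/
theorem enclosure_le {a₀ a₁ c d : ℝ} {M i j : ℕ} (hc : 0 < c) (ha₀ : 0 ≤ a₀) (ha : a₀ ≤ a₁)
    (hij : i < j) (hj : j < M) (h0 : d ≤ a₀ * c)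
    (hM : d ≤ (M : ℝ) ^ 2 * a₀ * c - ((M : ℝ) - 1) ^ 2 * a₁ * c) :
    a₁ * c * (i : ℝ) ^ 2 + d ≤ a₀ * c * (j : ℝ) ^ 2 ∧
      (d < a₀ * c → a₁ * c * (i : ℝ) ^ 2 + d < a₀ * c * (j : ℝ) ^ 2) := by
  have hi : (0 : ℝ) ≤ i := Nat.cast_nonneg i
  have hij' : (i : ℝ) + 1 ≤ j := by exact_mod_cast hij
  have hiM : (i : ℝ) + 2 ≤ M := by exact_mod_cast (by omega : i + 2 ≤ M)
  have hN : (0 : ℝ) < (M : ℝ) - 1 := by linarith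
  have ht : (0 : ℝ) < (M : ℝ) - 1 - i := by linarith
  have hsq : a₀ * c * ((i : ℝ) + 1) ^ 2 ≤ a₀ * c * (j : ℝ) ^ 2 := by gcongr
  have hconc : 0 ≤ c * ((a₁ - a₀) * i * ((M : ℝ) - 1) * ((M : ℝ) - 1 - i)) := by
    have := sub_nonneg.2 ha
    positivity
  -- Chord interpolation of the concave quadratic `g(t) = a₀c(t + 1)² - a₁ct² - d` between `t = 0`
  -- and `t = M - 1`; the last term is the excess due to concavity. As `i ≤ M - 2`, the weight of
  -- `g(0)` is positive, so strictness there carries over.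
  have hkey : ((M : ℝ) - 1) * (a₀ * c * ((i : ℝ) + 1) ^ 2 - a₁ * c * (i : ℝ) ^ 2 - d) =
      ((M : ℝ) - 1 - i) * (a₀ * c - d) +
      i * ((M : ℝ) ^ 2 * a₀ * c - ((M : ℝ) - 1) ^ 2 * a₁ * c - d) +
      c * ((a₁ - a₀) * i * ((M : ℝ) - 1) * ((M : ℝ) - 1 - i)) := by ring
  have h2 := mul_nonneg hi (sub_nonneg.2 hM)
  constructor
  · have h1 := mul_nonneg ht.le (sub_nonneg.2 h0)
    have h3 := nonneg_of_mul_nonneg_right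
      (hkey.symm ▸ (by positivity) : 0 ≤ ((M : ℝ) - 1) *
        (a₀ * c * ((i : ℝ) + 1) ^ 2 - a₁ * c * (i : ℝ) ^ 2 - d)) hN
    linarith
  · intro hlt
    have h1 := mul_pos ht (sub_pos.2 hlt)
    have h3 := (mul_pos_iff_of_pos_left hN).1
      (hkey.symm ▸ (by positivity) : 0 < ((M : ℝ) - 1) *
        (a₀ * c * ((i : ℝ) + 1) ^ 2 - a₁ * c * (i : ℝ) ^ 2 - d))
    linarith

theorem lemma2 (α β : ℝ) (hαβ : α < β) (a V : ℝ → ℝ)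
    (ha : ContDiffOn ℝ 1 a (Icc α β)) (ha_pos : ∀ x ∈ Icc α β, 0 < a x)
    (hV : MemLp V ⊤ (volume.restrict (Ioo α β)))
    (a₀ a₁ v₀ v₁ : ℝ)
    (ha_bd : ∀ x ∈ Ioo α β, a₀ ≤ a x ∧ a x ≤ a₁)
    (hV_bd : ∀ᵐ x ∂(volume.restrict (Ioo α β)), v₀ ≤ V x ∧ V x ≤ v₁) :
    (∃ ev : ℕ → ℝ, IsEigenvalueSequence (neumannOperator α β a V) ev) ∧
    ∀ ev : ℕ → ℝ, IsEigenvalueSequence (neumannOperator α β a V) ev →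
      (∀ i : ℕ,
        a₀ * Real.pi ^ 2 * (i : ℝ) ^ 2 / (β - α) ^ 2 + v₀ ≤ ev i ∧
        ev i ≤ a₁ * Real.pi ^ 2 * (i : ℝ) ^ 2 / (β - α) ^ 2 + v₁) ∧
      ∀ (E' : ℝ) (M : ℕ),
        IsLeast {m : ℕ | 1 ≤ m ∧
          E' ≤ v₀ + (m : ℝ) ^ 2 * a₀ * Real.pi ^ 2 / (β - α) ^ 2} M →
        0 ≤ v₁ - v₀ →
        v₁ - v₀ ≤ a₀ * Real.pi ^ 2 / (β - α) ^ 2 →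
        v₁ - v₀ ≤ (M : ℝ) ^ 2 * a₀ * Real.pi ^ 2 / (β - α) ^ 2
          - ((M : ℝ) - 1) ^ 2 * a₁ * Real.pi ^ 2 / (β - α) ^ 2 →
        (∀ i j : ℕ, i ≠ j → ev i < E' → ev j < E' →
          Disjoint
            (Ioo (a₀ * Real.pi ^ 2 * (i : ℝ) ^ 2 / (β - α) ^ 2 + v₀)
              (a₁ * Real.pi ^ 2 * (i : ℝ) ^ 2 / (β - α) ^ 2 + v₁))
            (Ioo (a₀ * Real.pi ^ 2 * (j : ℝ) ^ 2 / (β - α) ^ 2 + v₀)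
              (a₁ * Real.pi ^ 2 * (j : ℝ) ^ 2 / (β - α) ^ 2 + v₁))) ∧
        (v₁ - v₀ < a₀ * Real.pi ^ 2 / (β - α) ^ 2 →
          ∀ i j : ℕ, i ≠ j → ev i < E' → ev j < E' →
          Disjoint
            (Icc (a₀ * Real.pi ^ 2 * (i : ℝ) ^ 2 / (β - α) ^ 2 + v₀)
              (a₁ * Real.pi ^ 2 * (i : ℝ) ^ 2 / (β - α) ^ 2 + v₁))
            (Icc (a₀ * Real.pi ^ 2 * (j : ℝ) ^ 2 / (β - α) ^ 2 + v₀)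
              (a₁ * Real.pi ^ 2 * (j : ℝ) ^ 2 / (β - α) ^ 2 + v₁))) := by

  obtain ⟨ev₀, hmono, hev₀, hbd⟩ := exists_neumann_eigenvalues α β hαβ a V ha.continuousOn ha_pos
    hV.aestronglyMeasurable a₀ a₁ v₀ v₁ ha_bd hV_bd
  refine ⟨⟨ev₀, hev₀⟩, fun ev hev => ?_⟩
  obtain rfl := hev₀.eq_of_strictMono hmono hev
  have hL : 0 < β - α := sub_pos.2 hαβ
  set c := Real.pi ^ 2 / (β - α) ^ 2 with hc
  have hcpos : 0 < c := div_pos (pow_pos Real.pi_pos 2) (pow_pos hL 2)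
  have e1 : ∀ x y : ℝ, x * Real.pi ^ 2 * y / (β - α) ^ 2 = x * c * y := fun x y => by
    rw [hc]
    ring
  have e2 : ∀ x : ℝ, x * Real.pi ^ 2 / (β - α) ^ 2 = x * c := fun x => by
    rw [hc]
    ring
  have e3 : ∀ x y : ℝ, x * (y * Real.pi / (β - α)) ^ 2 = x * c * y ^ 2 := fun x y => by
    rw [hc, div_pow, mul_pow]
    ring
  simp only [e1, e2]
  simp only [e3] at hbd
  refine ⟨hbd, fun E' M hM hv h0 hN => ?_⟩
  -- The sign of `a₀` comes from `0 ≤ v₁ - v₀ ≤ a₀ c`.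
  have ha₀ : 0 ≤ a₀ := nonneg_of_mul_nonneg_left (hv.trans h0) hcpos
  have ha₀₁ : a₀ ≤ a₁ := by
    obtain ⟨x, hx⟩ := nonempty_Ioo.2 hαβ
    exact (ha_bd x hx).1.trans (ha_bd x hx).2
  -- The lower enclosure of `ev j` lies below `E'`, which is at most the lower enclosure of index
  -- `M`.
  have hlt : ∀ j : ℕ, ev j < E' → j < M := fun j hj => by
    have h1 : a₀ * c * (j : ℝ) ^ 2 < a₀ * c * (M : ℝ) ^ 2 := by
      have h2 := hM.1.2
      linarith [(hbd j).1]
    have h3 := lt_of_mul_lt_mul_left h1 (by positivity)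
    exact_mod_cast lt_of_pow_lt_pow_left₀ 2 (Nat.cast_nonneg M) h3
  have hord : ∀ i j : ℕ, i < j → ev j < E' →
      a₁ * c * (i : ℝ) ^ 2 + v₁ ≤ a₀ * c * (j : ℝ) ^ 2 + v₀ ∧
      (v₁ - v₀ < a₀ * c → a₁ * c * (i : ℝ) ^ 2 + v₁ < a₀ * c * (j : ℝ) ^ 2 + v₀) := by
    intro i j hij hj
    have h1 := enclosure_le hcpos ha₀ ha₀₁ hij (hlt j hj) h0 hN
    exact ⟨by linarith [h1.1], fun hs => by linarith [h1.2 hs]⟩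
  refine ⟨fun i j hij hi hj => ?_, fun hs i j hij hi hj => ?_⟩ <;> rw [Set.disjoint_left]
  · rintro x ⟨h1, h2⟩ ⟨h3, h4⟩
    rcases lt_or_gt_of_ne hij with h | h
    · linarith [(hord i j h hj).1]
    · linarith [(hord j i h hi).1]
  · rintro x ⟨h1, h2⟩ ⟨h3, h4⟩
    rcases lt_or_gt_of_ne hij with h | h
    · linarith [(hord i j h hj).2 hs]
    · linarith [(hord j i h hi).2 hs]
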